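/- **Setting.** Let $L,n\ge 1$ and $N=L^2$. There are $n$ agents $V$ occupying distinct sites of the $\sqrt N\times\sqrt N=L\times L$ triangular lattice with periodic boundary conditions (sites $(\mathbb Z/L)^2$, the six directions being $\pm(1,0),\pm(0,1),\pm(-1,1)$); two agents are adjacent if they occupy adjacent (distinct) sites. A behavior group vector $\hat\sigma:V\to\{\textsc{Unaware},\textsc{Mobile},\textsc{Immobile}\}$ is given; agents that are not Unaware are called Aware. An Unaware agent is *active* if it is adjacent to an Aware agent. Fix $\lambda>2+\sqrt2$. **Movement behavior of Adaptive $\alpha$-Compression.** In a *movement step* an agent $u$, at site $\ell$, is chosen uniformly at random. If $u$ is Immobile, nothing happens. Otherwise one of the six directions is chosen uniformly, giving a neighboring site $\ell'$. If $u$ is Unaware, it moves to $\ell'$ if and only if $\ell'$ is unoccupied. If $u$ is Mobile and the move is a valid compression move, it moves to $\ell'$ with probability $\min\{1,\lambda^{d'-d}\}$, where $d,d'$ are the numbers of Aware neighbors that $u$ has at $\ell$, respectively would have at $\ell'$; if the move is not valid, $u$ stays. Write $A,A'$ for the sets of sites adjacent to $\ell$, respectively $\ell'$, that are occupied by Aware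 agents other than $u$. The move is a *valid compression move* if $\ell'$ is unoccupied, $|A|<5$, and one of the following holds: (1) $A\cap A'\ne\emptyset$ and every site of $A\cup A'$ is joined to a site of $A\cap A'$ by a lattice path inside $A\cup A'$; (2) $A\cap A'=\emptyset$, $A$ and $A'$ are non-empty, any two sites of $A$ are joined by a lattice path inside $A$, and any two sites of $A'$ by a lattice path inside $A'$. Each agent activation is, independently with probability $\tfrac12$ each, a movement step or an iteration (state update), so the numbers of movement steps between consecutive iterations are independent and equal $j$ with probability $2^{-(j+1)}$, $j\ge 0$. Let $X_t$ be the lattice configuration at iteration $t$ and $G_t$ its adjacency graph on $V$. For given $\hat\sigma$, the law $\mathcal X(X_{t-1},\hat\sigma)$ of $(G_t,X_t)$ depends only on $X_{t-1}$ and $\hat\sigma$. **Recurring.** Let $U_D\ge1$ and $U_C\in(0,1)$. The movement behavior $\mathcal X$ is *$(U_D,U_C)$-recurring* if for every starting iteration $t\ge 1$, every value of $X_{t-1}$, and every $\hat\sigma$, kept fixed from then on, with at least one Unaware and at least one Immobile agent, there exist (on some probability space carrying the process $(G_s,X_s)_{s\ge t}$ generated by $\mathcal X$) non-negative integer random variables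 $D_1,D_2,\dots$ and $C_1,C_2,\dots$ such that for each $k\ge 1$: 1. $C_k$ is the total number of active agents between iterations $t+\sum_{i<k}D_i$ and $t+\sum_{i\le k}D_i-1$, i.e. the sum over these iterations $s$ of the number of active agents in $G_s$ under $\hat\sigma$; 2. $D_k$ is integrable and $\mathbb E[D_k\mid D_1,\dots,D_{k-1},C_1,\dots,C_{k-1}]\le U_D$ almost surely; 3. $\mathbb E\big[(1-\tfrac1n)^{C_k}\mid D_1,\dots,D_{k-1},C_1,\dots,C_{k-1}\big]\le U_C$ almost surely. **Lemma.** For all $n,L\ge 1$, with $N=L^2$, and all $\lambda>2+\sqrt2$, the movement behavior of Adaptive $\alpha$-Compression is $(U_D,U_C)$-recurring with $$U_D=2N^2+\frac2n+1,\qquad U_C=\frac23 .$$ -/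

import Mathlib

open MeasureTheory
open scoped NNReal ENNReal

noncomputable section

/-! ### Behavior groups and reconfiguration adversaries -/

/-- The three behavior groups of agents. `mobile` and `immobile` agents are the Aware ones. -/
inductive BehaviorGroup where
  | unaware
  | mobile
  | immobile
  deriving DecidableEq

/-- A reconfiguration adversary on the agent set `V` with information in `X`: it draws the pair
`(G_t, X_t)` from a distribution depending on `X_{t-1}` and on the behavior groups. -/
abbrev ReconfigurationAdversary (V X : Type) : Type :=
  X → (V → BehaviorGroup) → PMF (SimpleGraph V × X)

/-- The number of active agents of `G`: Unaware agents adjacent to at least one Aware agent. -/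
def activeCount {V : Type} (σ : V → BehaviorGroup) (G : SimpleGraph V) : ℕ :=
  {u : V | σ u = .unaware ∧ ∃ v, G.Adj u v ∧ σ v ≠ .unaware}.ncard

/-- The process `(G_s, X_s)`, `s ≥ t`, is generated by the adversary `𝒳` from iteration `t` on, when
the behavior groups stay equal to `σ` and the information before iteration `t` is `X_{t-1} = x₀`:
it is a Markov process with the transition probabilities of `𝒳`, i.e. it has the corresponding
finite-dimensional distributions. -/
structure IsGeneratedFrom {V X : Type} (𝒳 : ReconfigurationAdversary V X)
    (σ : V → BehaviorGroup) (t : ℕ) (x₀ : X) {Ω : Type} [MeasurableSpace Ω] (P : Measure Ω)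
    (G : ℕ → Ω → SimpleGraph V) (Y : ℕ → Ω → X) : Prop where
  measurable_graph : ∀ s (A : Set (SimpleGraph V)), MeasurableSet (G s ⁻¹' A)
  measurable_info : ∀ s (A : Set X), MeasurableSet (Y s ⁻¹' A)
  law : ∀ (m : ℕ) (g : ℕ → SimpleGraph V) (x : ℕ → X), x 0 = x₀ →
    P {ω | ∀ i < m, G (t + i) ω = g i ∧ Y (t + i) ω = x (i + 1)} =
      ∏ i ∈ Finset.range m, 𝒳 (x i) σ (g i, x (i + 1))

/-- The σ-algebra generated by `D₀, …, D_{k-1}, C₀, …, C_{k-1}`. -/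
abbrev batchHistory {Ω : Type} (D C : ℕ → Ω → ℕ) (k : ℕ) : MeasurableSpace Ω :=
  MeasurableSpace.comap (fun ω (i : Fin k) => (D i ω, C i ω)) inferInstance

/-- `(U_D, U_C)`-recurring reconfiguration adversaries. For every starting iteration `t ≥ 1`, every
value `x₀` of the information available there and every fixed behavior group vector with at least
one Unaware and one Immobile agent, some probability space carries the generated process together
with batch durations `D k` and batch counts `C k` (batches are numbered from `0`), where `C k` is
the total number of active agents over the iterations of the `k`-th batch. -/
def IsRecurring {V X : Type} [Fintype V] (𝒳 : ReconfigurationAdversary V X) (UD UC : ℝ) : Prop :=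
  1 ≤ UD ∧ 0 < UC ∧ UC < 1 ∧
  ∀ (t : ℕ), 1 ≤ t → ∀ (x₀ : X) (σ : V → BehaviorGroup),
    (∃ u, σ u = .unaware) → (∃ v, σ v = .immobile) →
    ∃ (Ω : Type) (_ : MeasurableSpace Ω) (P : Measure Ω) (_ : IsProbabilityMeasure P)
      (G : ℕ → Ω → SimpleGraph V) (Y : ℕ → Ω → X) (D C : ℕ → Ω → ℕ),
      IsGeneratedFrom 𝒳 σ t x₀ P G Y ∧
      ∀ k : ℕ,
        Measurable (D k) ∧ Measurable (C k) ∧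
        (∀ ω, C k ω = ∑ s ∈ Finset.Ico (t + ∑ i ∈ Finset.range k, D i ω)
          (t + ∑ i ∈ Finset.range (k + 1), D i ω), activeCount σ (G s ω)) ∧
        Integrable (fun ω => (D k ω : ℝ)) P ∧
        (∀ᵐ ω ∂P, (P[fun ω => (D k ω : ℝ) | batchHistory D C k]) ω ≤ UD) ∧
        (∀ᵐ ω ∂P, (P[fun ω => (1 - 1 / (Fintype.card V : ℝ)) ^ C k ω | batchHistory D C k]) ω ≤ UC)

/-! ### The triangular lattice with periodic boundary conditions -/

/-- Sites of the `L × L` piece of the triangular lattice with periodic boundary conditions, in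
coordinates with respect to two lattice vectors at an angle of 60 degrees. -/
abbrev Site (L : ℕ) : Type := ZMod L × ZMod L

/-- The six lattice directions, in counterclockwise order. -/
def latticeDir (L : ℕ) : Fin 6 → Site L :=
  ![(1, 0), (0, 1), (-1, 1), (-1, 0), (0, -1), (1, -1)]

lemma latticeDir_add_three (L : ℕ) (d : Fin 6) : latticeDir L (d + 3) = -latticeDir L d := by
  fin_cases d <;> simp [latticeDir]

/-- Adjacency of lattice sites. -/
def triangularLattice (L : ℕ) : SimpleGraph (Site L) where
  Adj x y := x ≠ y ∧ ∃ d, y = x + latticeDir L d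
  symm := ⟨by
    rintro x y ⟨hne, d, rfl⟩
    exact ⟨hne.symm, d + 3, by simp [latticeDir_add_three]⟩⟩
  loopless := ⟨fun _ h => h.1 rfl⟩

/-- A configuration: the agents occupy distinct sites. -/
abbrev LatticeConfig (V : Type) (L : ℕ) : Type := V ↪ Site L

/-- Two agents share an edge if they occupy adjacent sites. -/
def contactGraph {V : Type} {L : ℕ} (c : LatticeConfig V L) : SimpleGraph V :=
  (triangularLattice L).comap c

/-- The configuration after moving `u` to the unoccupied site `ℓ'`. -/
def moveAgent {V : Type} [DecidableEq V] {L : ℕ} (c : LatticeConfig V L) (u : V) (ℓ' : Site L)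
    (h : ∀ v, c v ≠ ℓ') : LatticeConfig V L where
  toFun := Function.update c u ℓ'
  inj' := by
    intro a b hab
    by_cases ha : a = u <;> by_cases hb : b = u
    · rw [ha, hb]
    · subst ha
      rw [Function.update_self, Function.update_of_ne hb] at hab
      exact absurd hab.symm (h b)
    · subst hb
      rw [Function.update_self, Function.update_of_ne ha] at hab
      exact absurd hab (h a)
    · rw [Function.update_of_ne ha, Function.update_of_ne hb] at hab
      exact c.injective hab

/-! ### Moves of Adaptive α-Compression -/

/-- The sites adjacent to `ℓ` that are occupied by Aware agents other than the moving agent `u`. -/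
def awareNbrs {V : Type} {L : ℕ} (σ : V → BehaviorGroup) (c : LatticeConfig V L) (u : V)
    (ℓ : Site L) : Set (Site L) :=
  {y | (triangularLattice L).Adj ℓ y ∧ ∃ v, v ≠ u ∧ σ v ≠ .unaware ∧ c v = y}

/-- `a` and `b` lie in `S` and are joined by a lattice path inside `S`. -/
def ConnectedWithin {L : ℕ} (S : Set (Site L)) (a b : Site L) : Prop :=
  ∃ (ha : a ∈ S) (hb : b ∈ S), ((triangularLattice L).induce S).Reachable ⟨a, ha⟩ ⟨b, hb⟩

/-- First local property of a valid compression move from `ℓ` to `ℓ'`, where `A = N(ℓ)` and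
`A' = N(ℓ')` are the sets of Aware neighbors (without the moving agent). -/
def MoveProperty1 {L : ℕ} (A A' : Set (Site L)) : Prop :=
  (A ∩ A').Nonempty ∧ ∀ a ∈ A ∪ A', ∃ b ∈ A ∩ A', ConnectedWithin (A ∪ A') a b

/-- Second local property of a valid compression move. -/
def MoveProperty2 {L : ℕ} (A A' : Set (Site L)) : Prop :=
  A ∩ A' = ∅ ∧ A.Nonempty ∧ A'.Nonempty ∧
    (∀ a ∈ A, ∀ b ∈ A, ConnectedWithin A a b) ∧ (∀ a ∈ A', ∀ b ∈ A', ConnectedWithin A' a b)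

/-- Moving `u` from its site to `ℓ'` is a valid compression move. -/
def ValidCompressionMove {V : Type} {L : ℕ} (σ : V → BehaviorGroup) (c : LatticeConfig V L)
    (u : V) (ℓ' : Site L) : Prop :=
  (∀ v, c v ≠ ℓ') ∧
  (MoveProperty1 (awareNbrs σ c u (c u)) (awareNbrs σ c u ℓ') ∨
    MoveProperty2 (awareNbrs σ c u (c u)) (awareNbrs σ c u ℓ')) ∧
  (awareNbrs σ c u (c u)).ncard < 5

/-- A coin showing `true` with probability `p`. -/
def coin (p : ℝ≥0) (hp : p ≤ 1) : PMF Bool :=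
  PMF.ofFintype (fun b => if b then (p : ℝ≥0∞) else ((1 - p : ℝ≥0) : ℝ≥0∞)) (by
    simp only [Fintype.sum_bool, if_true, Bool.false_eq_true, if_false]
    exact_mod_cast add_tsub_cancel_of_le hp)

open Classical in
/-- The procedure Execute-Gather: a random direction; a valid compression move is accepted with
probability `min 1 (lam ^ (d' - d))`, where `d` and `d'` are the numbers of Aware neighbors of `u`
before and after the move. -/
def executeGather {V : Type} [DecidableEq V] {L : ℕ} (lam : ℝ) (σ : V → BehaviorGroup)
    (c : LatticeConfig V L) (u : V) : PMF (LatticeConfig V L) :=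
  (PMF.uniformOfFintype (Fin 6)).bind fun d =>
    if h : ValidCompressionMove σ c u (c u + latticeDir L d) then
      (coin (min 1 (lam ^ (((awareNbrs σ c u (c u + latticeDir L d)).ncard : ℤ)
          - ((awareNbrs σ c u (c u)).ncard : ℤ))).toNNReal) (min_le_left _ _)).map
        fun accept => if accept then moveAgent c u _ h.1 else c
    else PMF.pure c

open Classical in
/-- The procedure Execute-Search: a random direction; move if the target site is unoccupied. -/
def executeSearch {V : Type} [DecidableEq V] {L : ℕ} (c : LatticeConfig V L) (u : V) :
    PMF (LatticeConfig V L) :=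
  (PMF.uniformOfFintype (Fin 6)).map fun d =>
    if h : ∀ v, c v ≠ c u + latticeDir L d then moveAgent c u _ h else c

/-- One movement step: a uniformly random agent is activated and, according to its behavior group,
does nothing, executes Gather or executes Search. -/
def movementStep {V : Type} [Fintype V] [Nonempty V] [DecidableEq V] {L : ℕ} (lam : ℝ)
    (σ : V → BehaviorGroup) (c : LatticeConfig V L) : PMF (LatticeConfig V L) :=
  (PMF.uniformOfFintype V).bind fun u =>
    match σ u with
    | .immobile => PMF.pure c
    | .mobile => executeGather lam σ c u
    | .unaware => executeSearch c u

/-- `j` consecutive movement steps. -/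
def movementSteps {V : Type} [Fintype V] [Nonempty V] [DecidableEq V] {L : ℕ} (lam : ℝ)
    (σ : V → BehaviorGroup) : ℕ → LatticeConfig V L → PMF (LatticeConfig V L)
  | 0, c => PMF.pure c
  | j + 1, c => (movementSteps lam σ j c).bind (movementStep lam σ)

/-- The number of movement steps between two consecutive iterations (state updates): every
activation is a movement step or a state update with probability `1/2` each, so this number is `j`
with probability `(1/2) ^ (j + 1)`. -/
def movementCount : PMF ℕ :=
  ⟨fun j => (2⁻¹ : ℝ≥0∞) ^ (j + 1), by
    have h : ∑' j : ℕ, (2⁻¹ : ℝ≥0∞) ^ (j + 1) = 1 := by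
      rw [ENNReal.tsum_geometric_add_one, ENNReal.one_sub_inv_two, inv_inv,
        ENNReal.inv_mul_cancel (by simp) (by simp)]
    exact h ▸ ENNReal.summable.hasSum⟩

/-- The movement behavior of Adaptive α-Compression with parameter `lam`, as a reconfiguration
adversary: the information is the lattice configuration, the graph its adjacency graph. -/
def compressionAdversary (V : Type) [Fintype V] [Nonempty V] [DecidableEq V] (L : ℕ) (lam : ℝ) :
    ReconfigurationAdversary V (LatticeConfig V L) := fun c σ =>
  (movementCount.bind fun j => movementSteps lam σ j c).map fun c' => (contactGraph c', c')

end

/-! Cut time into batches, each ending once `K = n / 2` (rounded down) further iterations show a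
contact, i.e. an Unaware agent next to an Aware one. Every such iteration has an active agent, so
almost surely a batch counts at least `K` of them, and Bernoulli's inequality gives (1 - 1/n)^K ≤
2/3. The work lies in bounding the expected length of a batch given the past.

This is done with a potential F, 0 ≤ F ≤ ρ (`exists_movement_potential`), whose expected change in a
movement step is at least 1 without contacts and at least -2ρ/n with a contact. A bounded quantity
cannot keep growing, so contactless iterations are rare: a batch has expected length at most K + ρ +
K·2ρ/n ≤ n/2 + 2ρ ≤ 2L⁴ + 1 (`sum_measure_batch_le`). At a contact F takes its maximum ρ, and a
given contact can only be destroyed by activating one of its two agents. The geometric number of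
movement steps carries the drift over to iterations.

Without contacts, F is a multiple of the sum over the Unaware agents of h(site of the agent, Aware
configuration). In that situation Aware agents move as if there were no Unaware ones, and the moves
of Unaware agents blocked by other Unaware agents contribute antisymmetric terms that cancel in the
sum (`exclusion_terms_cancel`). In the drift, each Unaware agent thus behaves like a free random
walk independent of the Aware set. For such a pair, with generator Q, let h be the expected time
before T = 2L²/5 during which the walk sits in the Aware set. Then Qh is the probability of sitting
there at time T minus the indicator of sitting there now (`exists_pair_potential`), and the
indicator vanishes since sites are distinct.

That probability is at least 0.8206 times a/L², where a is the number of Aware agents; only the size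
of the moving set matters, not how it moves. Indeed the walk is a product of three commuting walks
along lattice lines, each run for time T/3; each dominates 0.73 times the uniform law on its line
(`cycleKernel_ge`), and uniformity along any two of the directions is uniformity on the torus
(`torus_heat_lower_bound`). -/

noncomputable section

/-! ### The heat kernel on a cycle through Fourier modes. -/

section CyclicHeatKernel

variable {𝔸 : Type*} [NormedRing 𝔸] [NormedAlgebra ℝ 𝔸] [CompleteSpace 𝔸]

/-- The exponential acts on an eigenvector by the exponential of the eigenvalue. -/
lemma exp_mul_of_mul_eq_smul {X C : 𝔸} {μ : ℝ} (h : X * C = μ • C) :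
    NormedSpace.exp X * C = Real.exp μ • C := by
  have hpow : ∀ n : ℕ, X ^ n * C = μ ^ n • C := by
    intro n
    induction n with
    | zero => simp
    | succ n ih => rw [pow_succ, mul_assoc, h, mul_smul_comm, ih, smul_smul, pow_succ, mul_comm]
  have h1 := (NormedSpace.exp_series_hasSum_exp' (𝕂 := ℝ) X).mul_right C
  have h2 := (NormedSpace.exp_series_hasSum_exp' (𝕂 := ℝ) μ).smul_const C
  rw [← Real.exp_eq_exp_ℝ] at h2
  have e : (fun n : ℕ => ((n.factorial : ℝ))⁻¹ • X ^ n * C) =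
      fun n : ℕ => ((n.factorial : ℝ)⁻¹ • μ ^ n) • C := by
    funext n
    rw [smul_mul_assoc, hpow, smul_smul, smul_eq_mul]
  rw [e] at h1
  exact h1.unique h2

lemma sum_cyclic_shift {𝔸 : Type*} [Ring 𝔸] [Algebra ℝ 𝔸] {τ : 𝔸} {L : ℕ} (hL : 0 < L)
    (hτ : τ ^ L = 1) (a b : ℕ → ℝ) (h0 : b 0 = a (L - 1)) (hs : ∀ j, b (j + 1) = a j) :
    τ * ∑ j ∈ Finset.range L, a j • τ ^ j = ∑ j ∈ Finset.range L, b j • τ ^ j := by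
  obtain ⟨M, rfl⟩ : ∃ M, L = M + 1 := ⟨L - 1, by omega⟩
  rw [Finset.mul_sum, Finset.sum_range_succ, Finset.sum_range_succ' (fun j => b j • τ ^ j)]
  simp only [mul_smul_comm, ← pow_succ', hτ, hs, h0, Nat.add_sub_cancel, pow_zero]

/-- The discrete Fourier mode `k` as an element of the algebra generated by a cyclic shift. -/
def cyclicMode (τ : 𝔸) (L k : ℕ) : 𝔸 :=
  ∑ j ∈ Finset.range L, Real.cos (2 * Real.pi * k / L * j) • τ ^ j

-- Multiplying by the shift or its inverse moves the phase by one angle step, and the sum of the two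
-- cosines factors. The wrap-around is harmless because the phase gains a multiple of 2π over a full
-- period.
omit [CompleteSpace 𝔸] in
lemma cyclicMode_eigen {τ : 𝔸} {L : ℕ} (hL : 0 < L) (hτ : τ ^ L = 1) (k : ℕ) :
    ((1 / 2 : ℝ) • (τ + τ ^ (L - 1))) * cyclicMode τ L k =
      Real.cos (2 * Real.pi * k / L) • cyclicMode τ L k := by
  set θ : ℝ := 2 * Real.pi * k / L with hθ
  have hL' : (L : ℝ) ≠ 0 := by positivity
  have hθL : θ * L = k * (2 * Real.pi) := by rw [hθ]; field_simp
  have hper : ∀ x, Real.cos (x + θ * L) = Real.cos x := by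
    intro x; rw [hθL, Real.cos_add_nat_mul_two_pi]
  have e1 : τ * cyclicMode τ L k = ∑ j ∈ Finset.range L, Real.cos (θ * j - θ) • τ ^ j := by
    refine sum_cyclic_shift hL hτ _ (fun j => Real.cos (θ * j - θ)) ?_ ?_
    · rw [← hper, Nat.cast_sub hL]; congr 1; push_cast; ring
    · intro j; congr 1; push_cast; ring
  have e2 : τ ^ (L - 1) * cyclicMode τ L k =
      ∑ j ∈ Finset.range L, Real.cos (θ * j + θ) • τ ^ j := by
    have : τ * ∑ j ∈ Finset.range L, Real.cos (θ * j + θ) • τ ^ j = cyclicMode τ L k := by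
      refine sum_cyclic_shift hL hτ (fun j => Real.cos (θ * j + θ)) _ ?_ ?_
      · rw [← hper, Nat.cast_sub hL]; congr 1; push_cast; ring
      · intro j; congr 1; push_cast; ring
    rw [← this, ← mul_assoc, ← pow_succ, Nat.sub_add_cancel hL, hτ, one_mul]
  rw [smul_mul_assoc, add_mul, e1, e2, ← Finset.sum_add_distrib, cyclicMode, Finset.smul_sum,
    Finset.smul_sum]
  refine Finset.sum_congr rfl fun j _ => ?_
  rw [← add_smul, smul_smul, smul_smul, Real.cos_sub, Real.cos_add]
  congr 1; ring

lemma sum_cos_eq_zero {L j : ℕ} (hj : 0 < j) (hjL : j < L) :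
    ∑ k ∈ Finset.range L, Real.cos (2 * Real.pi * k / L * j) = 0 := by
  have hL : L ≠ 0 := by omega
  have hζ := Complex.isPrimitiveRoot_exp L hL
  have hne : (Complex.exp (2 * Real.pi * Complex.I / L)) ^ j ≠ 1 :=
    hζ.pow_ne_one_of_pos_of_lt hj.ne' hjL
  have hs : ∑ k ∈ Finset.range L, ((Complex.exp (2 * Real.pi * Complex.I / L)) ^ j) ^ k = 0 := by
    rw [geom_sum_eq hne, ← pow_mul, mul_comm j L, pow_mul, hζ.pow_eq_one]; simp
  have := congrArg Complex.re hs
  rw [Complex.re_sum, Complex.zero_re] at this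
  rw [← this]
  refine Finset.sum_congr rfl fun k _ => ?_
  rw [← pow_mul, ← Complex.exp_nat_mul, ← Complex.exp_ofReal_mul_I_re]
  congr 2
  push_cast; ring

omit [CompleteSpace 𝔸] in
lemma sum_cyclicMode {τ : 𝔸} {L : ℕ} (hL : 0 < L) :
    ∑ k ∈ Finset.range L, cyclicMode τ L k = (L : ℝ) • (1 : 𝔸) := by
  simp only [cyclicMode]
  rw [Finset.sum_comm]
  simp only [← Finset.sum_smul]
  rw [Finset.sum_eq_single 0]
  · simp
  · intro j hj hj0
    rw [sum_cos_eq_zero (Nat.pos_of_ne_zero hj0) (Finset.mem_range.1 hj), zero_smul]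
  · simp [hL.ne']

/-- The heat kernel of the simple random walk on a cycle of length `L` at time `s`. -/
def cycleKernel (L : ℕ) (s : ℝ) (j : ℕ) : ℝ :=
  1 / L * ∑ k ∈ Finset.range L,
    Real.exp (-(s * (1 - Real.cos (2 * Real.pi * k / L)))) * Real.cos (2 * Real.pi * k / L * j)

/-- By `sum_cyclicMode` the identity is a combination of eigenvectors, and the exponential acts on
each by a scalar. Only τ^L = 1 is used, so the same computation serves every lattice direction, also
on functions with a further coordinate. -/
lemma exp_cyclic_walk {τ : 𝔸} {L : ℕ} (hL : 0 < L) (hτ : τ ^ L = 1) (s : ℝ) :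
    NormedSpace.exp (s • ((1 / 2 : ℝ) • (τ + τ ^ (L - 1)) - 1)) =
      ∑ j ∈ Finset.range L, cycleKernel L s j • τ ^ j := by
  have hL' : (L : ℝ) ≠ 0 := by positivity
  have h1 : (1 : 𝔸) = (1 / L : ℝ) • ∑ k ∈ Finset.range L, cyclicMode τ L k := by
    rw [sum_cyclicMode hL, smul_smul, one_div_mul_cancel hL', one_smul]
  rw [← mul_one (NormedSpace.exp _)]
  nth_rw 2 [h1]
  rw [mul_smul_comm, Finset.mul_sum]
  have h2 : ∀ k, NormedSpace.exp (s • ((1 / 2 : ℝ) • (τ + τ ^ (L - 1)) - 1)) * cyclicMode τ L k =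
      Real.exp (-(s * (1 - Real.cos (2 * Real.pi * k / L)))) • cyclicMode τ L k := by
    intro k
    refine exp_mul_of_mul_eq_smul ?_
    rw [smul_mul_assoc, sub_mul, cyclicMode_eigen hL hτ, one_mul]
    module
  rw [Finset.sum_congr rfl fun k _ => h2 k]
  simp only [cycleKernel, cyclicMode, Finset.smul_sum, Finset.mul_sum, Finset.sum_smul]
  rw [Finset.sum_comm]
  refine Finset.sum_congr rfl fun j _ => Finset.sum_congr rfl fun k _ => ?_
  simp only [smul_smul]

end CyclicHeatKernel

/-! ### Quantitative mixing on the cycle at time 2L²/15. -/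

lemma two_mul_div_le_sin {L k : ℕ} (hk : 2 * k ≤ L) (hL : 0 < L) :
    2 * k / L ≤ Real.sin (Real.pi * k / L) := by
  have hL' : (0 : ℝ) < L := by positivity
  have hk' : (2 * k : ℝ) ≤ L := by exact_mod_cast hk
  have := Real.mul_le_sin (x := Real.pi * k / L) (by positivity)
    (by rw [div_le_div_iff₀ hL' two_pos]; nlinarith [Real.pi_pos])
  refine le_trans (le_of_eq ?_) this
  have := Real.pi_ne_zero
  field_simp

/-- Concavity of the sine between 0 and π/4, with equality at L = 4. The first mode dominates the
error, and there the linear bound of `two_mul_div_le_sin` would only give 4 in place of 8. -/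
lemma eight_le_sq_mul_sin_sq {L : ℕ} (hL : 4 ≤ L) :
    8 ≤ (L : ℝ) ^ 2 * Real.sin (Real.pi / L) ^ 2 := by
  have hL0 : (0 : ℝ) < L := by positivity
  have hL4 : (4 : ℝ) ≤ L := by exact_mod_cast hL
  have h0 : (0 : ℝ) ∈ Set.Icc 0 Real.pi := ⟨le_rfl, Real.pi_pos.le⟩
  have h1 : Real.pi / 4 ∈ Set.Icc 0 Real.pi := ⟨by positivity, by linarith [Real.pi_pos]⟩
  have ha : 0 ≤ 1 - 4 / (L : ℝ) := by rw [sub_nonneg, div_le_one hL0]; exact hL4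
  have hb : 0 ≤ 4 / (L : ℝ) := by positivity
  have hc := strictConcaveOn_sin_Icc.concaveOn.2 h0 h1 ha hb (by ring)
  simp only [Real.sin_zero, smul_eq_mul, mul_zero, zero_add, Real.sin_pi_div_four] at hc
  have e : 4 / (L : ℝ) * (Real.pi / 4) = Real.pi / L := by field_simp
  rw [e] at hc
  have h2 : (2 * Real.sqrt 2) ≤ L * Real.sin (Real.pi / L) := by
    have := mul_le_mul_of_nonneg_left hc hL0.le
    refine le_trans (le_of_eq ?_) this
    field_simp; ring
  have h3 : (2 * Real.sqrt 2) ^ 2 = 8 := by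
    rw [mul_pow, Real.sq_sqrt (by norm_num)]; norm_num
  rw [← mul_pow, ← h3]
  exact pow_le_pow_left₀ (by positivity) h2 2

lemma one_sub_cos_eq (x : ℝ) : 1 - Real.cos (2 * x) = 2 * Real.sin x ^ 2 := by
  rw [Real.cos_two_mul]; linarith [Real.sin_sq_add_cos_sq x]

lemma exp_neg_bound : Real.exp (-(32 / 15)) ≤ 1187 / 10000 := by
  have h1 : (2.7182818283 : ℝ) < Real.exp 1 := Real.exp_one_gt_d9
  have h2 : (10000 / 1187 : ℝ) ≤ Real.exp (32 / 15) := by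
    -- The fifteenth power turns the exponent into the integer 32, so a decimal lower bound for e
    -- suffices.
    have h15 : (10000 / 1187 : ℝ) ^ 15 ≤ Real.exp (32 / 15) ^ 15 := by
      rw [← Real.exp_nat_mul, show ((15 : ℕ) : ℝ) * (32 / 15) = (32 : ℕ) * 1 by norm_num,
        Real.exp_nat_mul]
      exact le_trans (by norm_num) (pow_le_pow_left₀ (by norm_num) h1.le 32)
    exact le_of_pow_le_pow_left₀ (by norm_num) (Real.exp_pos _).le h15
  rw [Real.exp_neg, inv_le_comm₀ (Real.exp_pos _) (by norm_num)]
  norm_num at h2 ⊢; exact h2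

/-- Upper bound for the Fourier mode at distance `k` of the heat kernel. -/
def modeBound (k : ℕ) : ℝ := if k = 1 then 1187 / 10000 else (1409 / 100000) ^ (k - 1)

lemma modeBound_nonneg (k : ℕ) : 0 ≤ modeBound k := by
  unfold modeBound; split_ifs <;> positivity

lemma sum_modeBound_le (M : ℕ) : ∑ k ∈ Finset.Ico 1 M, modeBound k ≤ 1335 / 10000 := by
  -- The coefficient 0.0148 makes m = 0 an equality, and exceeds 0.01409/(1 - 0.01409), which the
  -- geometric tail requires.
  have key : ∀ m : ℕ, ∑ k ∈ Finset.Ico 1 (m + 2), modeBound k ≤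
      1335 / 10000 - 148 / 10000 * (1409 / 100000) ^ m := by
    intro m
    induction m with
    | zero => norm_num [modeBound]
    | succ m ih =>
      rw [Finset.sum_Ico_succ_top (by omega)]
      have e : modeBound (m + 2) = 1409 / 100000 * (1409 / 100000) ^ m := by
        rw [modeBound, if_neg (by omega), show m + 2 - 1 = m + 1 by omega, pow_succ']
      have hp : (0 : ℝ) < (1409 / 100000) ^ m := by positivity
      rw [e, pow_succ]
      linarith
  rcases Nat.lt_or_ge M 2 with hM | hM
  · rw [Finset.Ico_eq_empty (by omega)]; norm_num
  · obtain ⟨m, rfl⟩ : ∃ m, M = m + 2 := ⟨M - 2, by omega⟩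
    exact (key m).trans (sub_le_self _ (by positivity))

/-- The Fourier modes of the heat kernel on the cycle at time `2 L² / 15`. -/
def cycleDecay (L k : ℕ) : ℝ :=
  Real.exp (-(2 * (L : ℝ) ^ 2 / 15 * (1 - Real.cos (2 * Real.pi * k / L))))

lemma cycleDecay_eq (L k : ℕ) : cycleDecay L k =
    Real.exp (-(4 / 15 * ((L : ℝ) ^ 2 * Real.sin (Real.pi * k / L) ^ 2))) := by
  rw [cycleDecay, show 2 * Real.pi * k / L = 2 * (Real.pi * k / L) by ring, one_sub_cos_eq]
  congr 1; ring

lemma cycleDecay_symm {L k : ℕ} (hL : 0 < L) (hk : k ≤ L) :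
    cycleDecay L (L - k) = cycleDecay L k := by
  have hL' : (L : ℝ) ≠ 0 := by positivity
  rw [cycleDecay_eq, cycleDecay_eq, Nat.cast_sub hk,
    show Real.pi * ((L : ℝ) - k) / L = Real.pi - Real.pi * k / L by field_simp, Real.sin_pi_sub]

lemma cycleDecay_le_modeBound {L k : ℕ} (hL : 4 ≤ L) (hk : 0 < k) (hkL : 2 * k ≤ L) :
    cycleDecay L k ≤ modeBound k := by
  have hL' : (0 : ℝ) < L := by positivity
  rw [cycleDecay_eq, modeBound]
  split_ifs with h1
  · subst h1
    refine le_trans (Real.exp_le_exp.2 ?_) exp_neg_bound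
    have := eight_le_sq_mul_sin_sq hL
    rw [Nat.cast_one, mul_one]
    linarith
  · have h2 : (2 * k : ℝ) ≤ L * Real.sin (Real.pi * k / L) := by
      have := mul_le_mul_of_nonneg_left (two_mul_div_le_sin hkL (by omega)) hL'.le
      refine le_trans (le_of_eq ?_) this
      field_simp
    have h3 : (2 * k : ℝ) ^ 2 ≤ (L : ℝ) ^ 2 * Real.sin (Real.pi * k / L) ^ 2 := by
      rw [← mul_pow]; exact pow_le_pow_left₀ (by positivity) h2 2
    obtain ⟨m, rfl⟩ : ∃ m, k = m + 1 := ⟨k - 1, by omega⟩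
    have hm : (1 : ℝ) ≤ m := by exact_mod_cast (by omega : 1 ≤ m)
    -- With k = m + 1 this says 16k²/15 ≥ 64(k - 1)/15, i.e. (k - 2)² ≥ 0; the Gaussian decay is
    -- traded for a geometric one.
    have h4 : -(4 / 15 * ((L : ℝ) ^ 2 * Real.sin (Real.pi * (m + 1 : ℕ) / L) ^ 2)) ≤
        ((m * 2 : ℕ) : ℝ) * (-(32 / 15)) := by
      push_cast at h3 ⊢
      nlinarith
    rw [Nat.add_sub_cancel]
    calc _ ≤ _ := Real.exp_le_exp.2 h4
      _ = (Real.exp (-(32 / 15)) ^ 2) ^ m := by rw [Real.exp_nat_mul, ← pow_mul, mul_comm 2 m]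
      _ ≤ _ := by
        refine pow_le_pow_left₀ (by positivity) ?_ m
        exact (pow_le_pow_left₀ (Real.exp_pos _).le exp_neg_bound 2).trans (by norm_num)

/-- Modes k and L - k agree, so each half of the spectrum contributes at most 0.1335. -/
lemma sum_cycleDecay_le {L : ℕ} (hL : 4 ≤ L) :
    ∑ k ∈ Finset.Ico 1 L, cycleDecay L k ≤ 27 / 100 := by
  have h1 : ∀ k ∈ Finset.Ico 1 L, cycleDecay L k ≤ modeBound k + modeBound (L - k) := by
    intro k hk
    rw [Finset.mem_Ico] at hk
    rcases le_total (2 * k) L with h | h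
    · linarith [cycleDecay_le_modeBound hL hk.1 h, modeBound_nonneg (L - k)]
    · rw [← cycleDecay_symm (by omega) hk.2.le]
      linarith [cycleDecay_le_modeBound hL (k := L - k) (by omega) (by omega), modeBound_nonneg k]
  have h2 : ∑ k ∈ Finset.Ico 1 L, modeBound (L - k) = ∑ k ∈ Finset.Ico 1 L, modeBound k := by
    refine Finset.sum_nbij' (fun k => L - k) (fun k => L - k) ?_ ?_ ?_ ?_ ?_ <;>
      simp only [Finset.mem_Ico] <;> intros <;> first | omega | trivial
  calc _ ≤ _ := Finset.sum_le_sum h1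
    _ ≤ _ := by rw [Finset.sum_add_distrib, h2]; linarith [sum_modeBound_le L]

lemma neg_half_le_cos_third (m : ℕ) : -(1 / 2) ≤ Real.cos (2 * Real.pi * m / 3) := by
  obtain ⟨q, r, hr, rfl⟩ : ∃ q r, r < 3 ∧ m = 3 * q + r :=
    ⟨m / 3, m % 3, Nat.mod_lt _ (by norm_num), (Nat.div_add_mod m 3).symm⟩
  have e : 2 * Real.pi * ((3 * q + r : ℕ) : ℝ) / 3 =
      2 * Real.pi * r / 3 + q * (2 * Real.pi) := by push_cast; ring
  rw [e, Real.cos_add_nat_mul_two_pi]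
  have h3 : Real.cos (2 * (Real.pi / 3)) = -(1 / 2) := by
    rw [Real.cos_two_mul, Real.cos_pi_div_three]; norm_num
  interval_cases r
  · norm_num
  · rw [← h3]; apply le_of_eq; congr 1; push_cast; ring
  · have : 2 * Real.pi * (2 : ℕ) / 3 = 2 * Real.pi - 2 * (Real.pi / 3) := by push_cast; ring
    rw [this, Real.cos_two_pi_sub, h3]

/-- At time `2 L² / 15` the walk on the cycle is close to equilibrium. -/
lemma cycleKernel_ge {L : ℕ} (hL : 3 ≤ L) (j : ℕ) :
    73 / 100 / (L : ℝ) ≤ cycleKernel L (2 * (L : ℝ) ^ 2 / 15) j := by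
  have hL' : (0 : ℝ) < L := by positivity
  have hkey : 73 / 100 ≤ ∑ k ∈ Finset.range L,
      cycleDecay L k * Real.cos (2 * Real.pi * k / L * j) := by
    rw [Finset.range_eq_Ico, Finset.sum_eq_sum_Ico_succ_bot (by omega)]
    have h0 : cycleDecay L 0 * Real.cos (2 * Real.pi * (0 : ℕ) / L * j) = 1 := by
      simp [cycleDecay]
    rw [h0, zero_add]
    rcases Nat.lt_or_ge L 4 with h | h
    -- For L = 3 the constant 8 of `eight_le_sq_mul_sin_sq` drops to 27/4. Instead, both nontrivial
    -- modes have equal weight and their cosines are at least -1/2, so together they cost only one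
    -- weight.
    · obtain rfl : L = 3 := by omega
      have h1 := cycleDecay_eq 3 1
      have h2 : cycleDecay 3 2 = cycleDecay 3 1 :=
        cycleDecay_symm (L := 3) (k := 1) (by norm_num) (by norm_num)
      have hd : cycleDecay 3 1 ≤ 27 / 100 := by
        rw [h1]
        have hs : Real.sin (Real.pi * (1 : ℕ) / (3 : ℕ)) ^ 2 = 3 / 4 := by
          rw [Nat.cast_one, mul_one, Nat.cast_ofNat, Real.sin_pi_div_three, div_pow,
            Real.sq_sqrt (by norm_num)]
          norm_num
        rw [hs]
        have h5 : Real.exp (-(4 / 15 * (((3 : ℕ) : ℝ) ^ 2 * (3 / 4)))) ≤ Real.exp (-(3 / 2)) :=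
          Real.exp_le_exp.2 (by norm_num)
        have h6 : Real.exp (-(3 / 2)) ≤ 27 / 100 := by
          rw [Real.exp_neg, inv_le_comm₀ (Real.exp_pos _) (by norm_num)]
          refine le_of_pow_le_pow_left₀ two_ne_zero (Real.exp_pos _).le ?_
          rw [← Real.exp_nat_mul, show ((2 : ℕ) : ℝ) * (3 / 2) = (3 : ℕ) * 1 by norm_num,
            Real.exp_nat_mul]
          exact le_trans (by norm_num) (pow_le_pow_left₀ (by norm_num) Real.exp_one_gt_d9.le 3)
        exact h5.trans h6
      have hd0 : 0 ≤ cycleDecay 3 1 := (Real.exp_pos _).le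
      have c1 := neg_half_le_cos_third (1 * j)
      have c2 := neg_half_le_cos_third (2 * j)
      rw [Finset.sum_Ico_succ_top (by norm_num), Finset.sum_Ico_succ_top (by norm_num), h2]
      simp only [Finset.Ico_self, Finset.sum_empty, zero_add]
      have e1 : ∀ q : ℕ, 2 * Real.pi * (q : ℝ) / (3 : ℕ) * j = 2 * Real.pi * (q * j : ℕ) / 3 := by
        intro q; push_cast; ring
      rw [e1, e1]
      nlinarith
    · have h1 : ∀ k ∈ Finset.Ico 1 L, -cycleDecay L k ≤
          cycleDecay L k * Real.cos (2 * Real.pi * k / L * j) := by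
        intro k _
        have hd0 : 0 ≤ cycleDecay L k := (Real.exp_pos _).le
        nlinarith [Real.neg_one_le_cos (2 * Real.pi * k / L * j)]
      have h2 := Finset.sum_le_sum h1
      rw [Finset.sum_neg_distrib] at h2
      linarith [sum_cycleDecay_le h]
  rw [cycleKernel, div_eq_mul_one_div, mul_comm (73 / 100 : ℝ)]
  exact mul_le_mul_of_nonneg_left hkey (by positivity)

/-! ### Positive operators and the semigroups they generate. -/

section PositiveOperators

variable {ι : Type*}

/-- Operators on functions that preserve nonnegativity. -/
def IsPositiveOp (X : (ι → ℝ) →L[ℝ] (ι → ℝ)) : Prop := ∀ f, 0 ≤ f → 0 ≤ X f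

namespace IsPositiveOp

variable {X Y : (ι → ℝ) →L[ℝ] (ι → ℝ)}

lemma one : IsPositiveOp (1 : (ι → ℝ) →L[ℝ] (ι → ℝ)) := fun _ hf => hf

lemma mul (hX : IsPositiveOp X) (hY : IsPositiveOp Y) : IsPositiveOp (X * Y) :=
  fun f hf => hX _ (hY f hf)

lemma add (hX : IsPositiveOp X) (hY : IsPositiveOp Y) : IsPositiveOp (X + Y) :=
  fun f hf => add_nonneg (hX f hf) (hY f hf)

lemma smul (hX : IsPositiveOp X) {c : ℝ} (hc : 0 ≤ c) : IsPositiveOp (c • X) :=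
  fun f hf => smul_nonneg hc (hX f hf)

lemma sum {κ : Type*} {s : Finset κ} {F : κ → (ι → ℝ) →L[ℝ] (ι → ℝ)}
    (h : ∀ k ∈ s, IsPositiveOp (F k)) : IsPositiveOp (∑ k ∈ s, F k) := by
  intro f hf
  rw [sum_apply]
  exact Finset.sum_nonneg fun k hk => h k hk f hf

lemma pow (hX : IsPositiveOp X) (n : ℕ) : IsPositiveOp (X ^ n) := by
  induction n with
  | zero => simpa using one
  | succ n ih => rw [pow_succ]; exact ih.mul hX

lemma mono (hX : IsPositiveOp X) {f g : ι → ℝ} (h : f ≤ g) : X f ≤ X g := by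
  have := hX (g - f) (sub_nonneg.2 h)
  rwa [map_sub, sub_nonneg] at this

variable [Fintype ι] in
lemma exp (hX : IsPositiveOp X) : IsPositiveOp (NormedSpace.exp X) := by
  intro f hf
  have h1 := (NormedSpace.exp_series_hasSum_exp' (𝕂 := ℝ) X)
  have h2 := h1.mapL (ContinuousLinearMap.apply ℝ (ι → ℝ) f)
  refine h2.nonneg fun n => ?_
  exact ((hX.pow n).smul (by positivity)) f hf

end IsPositiveOp

variable [Fintype ι]

lemma exp_smul_one (c : ℝ) : NormedSpace.exp (c • (1 : (ι → ℝ) →L[ℝ] (ι → ℝ))) =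
    Real.exp c • 1 := by
  have := exp_mul_of_mul_eq_smul (X := c • (1 : (ι → ℝ) →L[ℝ] (ι → ℝ))) (C := 1) (μ := c) (by simp)
  rwa [mul_one] at this

/-- The semigroup generated by a positive operator minus a constant is positive. -/
lemma IsPositiveOp.exp_sub {X : (ι → ℝ) →L[ℝ] (ι → ℝ)} (hX : IsPositiveOp X) (c : ℝ) {t : ℝ}
    (ht : 0 ≤ t) : IsPositiveOp (NormedSpace.exp (t • (X - c • 1))) := by
  have e : t • (X - c • 1) = t • X + (-(t * c)) • (1 : (ι → ℝ) →L[ℝ] (ι → ℝ)) := by module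
  let _ : NormedAlgebra ℚ ((ι → ℝ) →L[ℝ] (ι → ℝ)) := NormedAlgebra.restrictScalars ℚ ℝ _
  rw [e, NormedSpace.exp_add_of_commute ((Commute.one_right _).smul_right _), exp_smul_one]
  exact (hX.smul ht).exp.mul (IsPositiveOp.one.smul (Real.exp_pos _).le)

lemma exp_apply_of_apply_eq_zero {X : (ι → ℝ) →L[ℝ] (ι → ℝ)} {f : ι → ℝ} (h : X f = 0) :
    NormedSpace.exp X f = f := by
  have h1 := (NormedSpace.exp_series_hasSum_exp' (𝕂 := ℝ) X)
  have h2 := h1.mapL (ContinuousLinearMap.apply ℝ (ι → ℝ) f)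
  refine h2.unique ?_
  have h3 := hasSum_single (f := fun n : ℕ => (ContinuousLinearMap.apply ℝ (ι → ℝ) f)
    ((n.factorial : ℝ)⁻¹ • X ^ n)) 0 (fun n hn => by
      obtain ⟨m, rfl⟩ := Nat.exists_eq_succ_of_ne_zero hn
      simp [pow_succ, h])
  simpa using h3

end PositiveOperators

/-! ### Shifts, averages and the heat kernel on the torus. -/

section Torus

variable {L : ℕ} {β : Type*} [NeZero L] [Fintype β]

/-- Translation of the lattice coordinate. -/
def siteShift (d : Site L) : (Site L × β → ℝ) →L[ℝ] (Site L × β → ℝ) :=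
  LinearMap.toContinuousLinearMap (LinearMap.funLeft ℝ ℝ fun p => (p.1 + d, p.2))

@[simp] lemma siteShift_apply (d : Site L) (f : Site L × β → ℝ) (p : Site L × β) :
    siteShift d f p = f (p.1 + d, p.2) := rfl

lemma siteShift_mul (d e : Site L) :
    (siteShift d * siteShift e : (Site L × β → ℝ) →L[ℝ] (Site L × β → ℝ)) = siteShift (d + e) := by
  ext f p; simp [add_assoc]

lemma siteShift_zero : (siteShift 0 : (Site L × β → ℝ) →L[ℝ] (Site L × β → ℝ)) = 1 := by
  ext f p; simp

lemma siteShift_pow (d : Site L) (j : ℕ) :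
    (siteShift d : (Site L × β → ℝ) →L[ℝ] (Site L × β → ℝ)) ^ j = siteShift ((j : ZMod L) • d) := by
  induction j with
  | zero => simp [siteShift_zero]
  | succ j ih => rw [pow_succ, ih, siteShift_mul]; congr 1; push_cast; rw [add_smul, one_smul]

lemma siteShift_pow_card (d : Site L) :
    (siteShift d : (Site L × β → ℝ) →L[ℝ] (Site L × β → ℝ)) ^ L = 1 := by
  rw [siteShift_pow]; simp [siteShift_zero]

lemma siteShift_comm (d e : Site L) :
    Commute (siteShift d : (Site L × β → ℝ) →L[ℝ] (Site L × β → ℝ)) (siteShift e) := by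
  rw [Commute, SemiconjBy, siteShift_mul, siteShift_mul, add_comm]

lemma siteShift_pos (d : Site L) :
    IsPositiveOp (siteShift d : (Site L × β → ℝ) →L[ℝ] (Site L × β → ℝ)) :=
  fun _ hf p => hf (p.1 + d, p.2)

/-- One step of the simple random walk along a line of the lattice. -/
def lineWalk (d : Site L) : (Site L × β → ℝ) →L[ℝ] (Site L × β → ℝ) :=
  (1 / 2 : ℝ) • (siteShift d + siteShift d ^ (L - 1))

lemma lineWalk_apply (d : Site L) (f : Site L × β → ℝ) (x : Site L) (b : β) :
    lineWalk d f (x, b) = (f (x + d, b) + f (x + -d, b)) / 2 := by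
  have : ((L - 1 : ℕ) : ZMod L) = -1 := by
    rw [Nat.cast_sub NeZero.one_le]; simp
  simp [lineWalk, siteShift_pow, this]
  ring

/-- Averaging over a line of the lattice. -/
def lineAverage (d : Site L) : (Site L × β → ℝ) →L[ℝ] (Site L × β → ℝ) :=
  (1 / L : ℝ) • ∑ j ∈ Finset.range L, siteShift d ^ j

lemma sum_range_zmod {M : Type*} [AddCommMonoid M] (F : ZMod L → M) :
    ∑ j ∈ Finset.range L, F j = ∑ z, F z := by
  refine Finset.sum_bij' (fun j _ => (j : ZMod L)) (fun z _ => z.val) ?_ ?_ ?_ ?_ ?_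
  · simp
  · intro z _; simpa using ZMod.val_lt z
  · intro j hj; exact ZMod.val_cast_of_lt (Finset.mem_range.1 hj)
  · intro z _; exact ZMod.natCast_zmod_val z
  · simp

lemma lineAverage_apply (d : Site L) (f : Site L × β → ℝ) (x : Site L) (b : β) :
    lineAverage d f (x, b) = 1 / L * ∑ z : ZMod L, f (x + z • d, b) := by
  simp only [lineAverage, siteShift_pow]
  rw [← sum_range_zmod]
  simp

/-- Averaging over all lattice sites. -/
def siteAverage : (Site L × β → ℝ) →L[ℝ] (Site L × β → ℝ) :=
  (1 / (L : ℝ) ^ 2) • ∑ d : Site L, siteShift d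

lemma siteAverage_apply (f : Site L × β → ℝ) (x : Site L) (b : β) :
    siteAverage f (x, b) = 1 / (L : ℝ) ^ 2 * ∑ y : Site L, f (y, b) := by
  simp only [siteAverage, smul_apply, sum_apply,
    Pi.smul_apply, Finset.sum_apply, siteShift_apply, smul_eq_mul]
  congr 1
  exact Equiv.sum_comp (Equiv.addLeft x) fun y => f (y, b)

lemma siteShift_mul_siteAverage (d : Site L) :
    (siteShift d * siteAverage : (Site L × β → ℝ) →L[ℝ] (Site L × β → ℝ)) = siteAverage := by
  ext f ⟨x, b⟩
  simp [siteAverage_apply]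

lemma siteShift_commute_siteAverage (d : Site L) :
    Commute (siteShift d : (Site L × β → ℝ) →L[ℝ] (Site L × β → ℝ)) siteAverage :=
  (Commute.sum_right _ _ _ fun e _ => siteShift_comm d e).smul_right _

/-- An injective self-map of a finite set is bijective, so the double sum meets every site exactly
once. -/
lemma lineAverage_mul {d e : Site L}
    (h : Function.Injective fun p : ZMod L × ZMod L => p.1 • d + p.2 • e) :
    (lineAverage d * lineAverage e : (Site L × β → ℝ) →L[ℝ] (Site L × β → ℝ)) = siteAverage := by
  ext f ⟨x, b⟩
  have hb := Finite.injective_iff_bijective.1 h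
  change lineAverage d (lineAverage e f) (x, b) = _
  rw [siteAverage_apply, lineAverage_apply]
  simp only [lineAverage_apply]
  rw [← Finset.mul_sum, ← mul_assoc]
  congr 1
  · field_simp
  · rw [← Equiv.sum_comp (Equiv.addLeft x) (fun y => f (y, b)),
      ← Function.Bijective.sum_comp hb (fun y => f ((Equiv.addLeft x) y, b)), Fintype.sum_prod_type]
    simp [add_assoc]

lemma lineAverage_mul_siteAverage (d : Site L) :
    (lineAverage d * siteAverage : (Site L × β → ℝ) →L[ℝ] (Site L × β → ℝ)) = siteAverage := by
  ext f ⟨x, b⟩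
  change lineAverage d (siteAverage f) (x, b) = _
  rw [lineAverage_apply]
  simp only [siteAverage_apply]
  have : (L : ℝ) ≠ 0 := NeZero.ne _
  simp
  field_simp

/-- The part of the heat kernel along a line that exceeds a multiple of the uniform average. -/
def lineRest (d : Site L) : (Site L × β → ℝ) →L[ℝ] (Site L × β → ℝ) :=
  ∑ j ∈ Finset.range L,
    (cycleKernel L (2 * (L : ℝ) ^ 2 / 15) j - 73 / 100 / L) • siteShift d ^ j

lemma lineRest_pos (hL : 3 ≤ L) (d : Site L) :
    IsPositiveOp (lineRest d : (Site L × β → ℝ) →L[ℝ] (Site L × β → ℝ)) :=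
  IsPositiveOp.sum fun j _ => ((siteShift_pos d).pow j).smul (sub_nonneg.2 (cycleKernel_ge hL j))

lemma lineAverage_pos (d : Site L) :
    IsPositiveOp (lineAverage d : (Site L × β → ℝ) →L[ℝ] (Site L × β → ℝ)) :=
  (IsPositiveOp.sum fun j _ => (siteShift_pos d).pow j).smul (by positivity)

lemma exp_lineWalk (d : Site L) :
    NormedSpace.exp ((2 * (L : ℝ) ^ 2 / 15) •
      (lineWalk d - 1 : (Site L × β → ℝ) →L[ℝ] (Site L × β → ℝ))) =
      (73 / 100 : ℝ) • lineAverage d + lineRest d := by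
  rw [lineWalk, exp_cyclic_walk (NeZero.pos L) (siteShift_pow_card d), lineRest, lineAverage,
    smul_smul, Finset.smul_sum, ← Finset.sum_add_distrib]
  refine Finset.sum_congr rfl fun j _ => ?_
  rw [← add_smul]
  congr 1
  ring

/-- The line semigroup and the line average both fix functions that are constant in the site; the
rest must carry the remaining mass 1 - 0.73. -/
lemma lineRest_mul_siteAverage (d : Site L) :
    (lineRest d * siteAverage : (Site L × β → ℝ) →L[ℝ] (Site L × β → ℝ)) =
      (27 / 100 : ℝ) • siteAverage := by
  have h0 : (((2 * (L : ℝ) ^ 2 / 15) • (lineWalk d - 1)) * siteAverage :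
      (Site L × β → ℝ) →L[ℝ] (Site L × β → ℝ)) = (0 : ℝ) • siteAverage := by
    rw [smul_mul_assoc, sub_mul, lineWalk, smul_mul_assoc, add_mul, siteShift_pow,
      siteShift_mul_siteAverage, siteShift_mul_siteAverage, one_mul]
    module
  have h1 := exp_mul_of_mul_eq_smul h0
  rw [exp_lineWalk, add_mul, smul_mul_assoc, lineAverage_mul_siteAverage, Real.exp_zero,
    one_smul] at h1
  rw [← eq_sub_iff_add_eq'] at h1
  rw [h1]; module

lemma lineRest_commute_lineAverage (d e : Site L) :
    Commute (lineRest d : (Site L × β → ℝ) →L[ℝ] (Site L × β → ℝ)) (lineAverage e) :=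
  Commute.sum_left _ _ _ fun j _ => ((Commute.sum_right _ _ _ fun i _ =>
    (siteShift_comm d e).pow_pow j i).smul_right _).smul_left _

/-- The heat kernel on the torus dominates a multiple of the uniform average. -/
lemma torus_heat_lower_bound (hL : 3 ≤ L) {d₁ d₂ d₃ : Site L}
    (h12 : Function.Injective fun p : ZMod L × ZMod L => p.1 • d₁ + p.2 • d₂)
    (h13 : Function.Injective fun p : ZMod L × ZMod L => p.1 • d₁ + p.2 • d₃)
    (h23 : Function.Injective fun p : ZMod L × ZMod L => p.1 • d₂ + p.2 • d₃)
    {f : Site L × β → ℝ} (hf : 0 ≤ f) :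
    (8206 / 10000 : ℝ) • siteAverage f ≤
      (((73 / 100 : ℝ) • lineAverage d₁ + lineRest d₁) *
        ((73 / 100 : ℝ) • lineAverage d₂ + lineRest d₂) *
        ((73 / 100 : ℝ) • lineAverage d₃ + lineRest d₃) :
          (Site L × β → ℝ) →L[ℝ] (Site L × β → ℝ)) f := by
  set c : ℝ := 73 / 100 with hc
  set U₁ : (Site L × β → ℝ) →L[ℝ] (Site L × β → ℝ) := lineAverage d₁ with hU1
  set U₂ : (Site L × β → ℝ) →L[ℝ] (Site L × β → ℝ) := lineAverage d₂ with hU2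
  set U₃ : (Site L × β → ℝ) →L[ℝ] (Site L × β → ℝ) := lineAverage d₃ with hU3
  set R₁ : (Site L × β → ℝ) →L[ℝ] (Site L × β → ℝ) := lineRest d₁ with hR1
  set R₂ : (Site L × β → ℝ) →L[ℝ] (Site L × β → ℝ) := lineRest d₂ with hR2
  set R₃ : (Site L × β → ℝ) →L[ℝ] (Site L × β → ℝ) := lineRest d₃ with hR3
  set U : (Site L × β → ℝ) →L[ℝ] (Site L × β → ℝ) := siteAverage with hU
  have pU : ∀ d : Site L, IsPositiveOp (lineAverage d : (Site L × β → ℝ) →L[ℝ] _) := lineAverage_pos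
  have pR : ∀ d : Site L, IsPositiveOp (lineRest d : (Site L × β → ℝ) →L[ℝ] _) := lineRest_pos hL
  have e12 : U₁ * U₂ = U := lineAverage_mul h12
  have e13 : U₁ * U₃ = U := lineAverage_mul h13
  have e23 : U₂ * U₃ = U := lineAverage_mul h23
  have e123 : U₁ * U₂ * U₃ = U := by rw [mul_assoc, e23, hU1, lineAverage_mul_siteAverage]
  have r1 : R₁ * U₂ * U₃ = (27 / 100 : ℝ) • U := by
    rw [mul_assoc, e23]; exact lineRest_mul_siteAverage _
  have r2 : U₁ * R₂ * U₃ = (27 / 100 : ℝ) • U := by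
    rw [← (lineRest_commute_lineAverage d₂ d₁).eq, mul_assoc, e13]
    exact lineRest_mul_siteAverage _
  have r3 : U₁ * U₂ * R₃ = (27 / 100 : ℝ) • U := by
    rw [mul_assoc, ← (lineRest_commute_lineAverage d₃ d₂).eq, ← mul_assoc,
      ← (lineRest_commute_lineAverage d₃ d₁).eq, mul_assoc, e12]
    exact lineRest_mul_siteAverage _
  -- Every product containing at least two averages collapses to the full average: 0.820666 = 0.73³
  -- + 3·0.73²·0.27. The other four products are positive and are dropped.
  have hexp : (c • U₁ + R₁) * (c • U₂ + R₂) * (c • U₃ + R₃) =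
      (820666 / 1000000 : ℝ) • U + (c • (U₁ * R₂ * R₃) + c • (R₁ * U₂ * R₃) +
        c • (R₁ * R₂ * U₃) + R₁ * R₂ * R₃) := by
    have : (c • U₁ + R₁) * (c • U₂ + R₂) * (c • U₃ + R₃) =
        c ^ 3 • (U₁ * U₂ * U₃) + c ^ 2 • (U₁ * U₂ * R₃) + c ^ 2 • (U₁ * R₂ * U₃) +
        c ^ 2 • (R₁ * U₂ * U₃) + (c • (U₁ * R₂ * R₃) + c • (R₁ * U₂ * R₃) +
        c • (R₁ * R₂ * U₃) + R₁ * R₂ * R₃) := by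
      simp only [add_mul, mul_add, smul_mul_assoc, mul_smul_comm]
      module
    rw [this, e123, r1, r2, r3, hc]
    module
  have hrest : IsPositiveOp (c • (U₁ * R₂ * R₃) + c • (R₁ * U₂ * R₃) +
        c • (R₁ * R₂ * U₃) + R₁ * R₂ * R₃) := by
    have hc0 : 0 ≤ c := by norm_num [hc]
    exact (((((pU _).mul (pR _)).mul (pR _)).smul hc0).add
      ((((pR _).mul (pU _)).mul (pR _)).smul hc0)).add
      ((((pR _).mul (pR _)).mul (pU _)).smul hc0) |>.add (((pR _).mul (pR _)).mul (pR _))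
  have hUf : 0 ≤ U f := by
    rw [← e12]; exact ((pU _).mul (pU _)) f hf
  rw [hexp, add_apply, smul_apply]
  intro p
  have h1 := hrest f hf p
  have h2 := hUf p
  simp only [Pi.add_apply, Pi.smul_apply, smul_eq_mul, Pi.zero_apply] at h1 h2 ⊢
  linarith

end Torus

/-! ### The potential of a random walk and an independent moving set. -/

section Potential

variable {L : ℕ} {β : Type*} [NeZero L] [Fintype β]

/-- An operator acting on the second coordinate only. -/
def sndOp (S : (β → ℝ) →ₗ[ℝ] (β → ℝ)) : (Site L × β → ℝ) →L[ℝ] (Site L × β → ℝ) :=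
  LinearMap.toContinuousLinearMap
    { toFun := fun f p => S (fun b => f (p.1, b)) p.2
      map_add' := fun f g => by
        ext p
        exact congrFun (S.map_add (fun b => f (p.1, b)) fun b => g (p.1, b)) p.2
      map_smul' := fun c f => by
        ext p
        exact congrFun (S.map_smul c fun b => f (p.1, b)) p.2 }

lemma sndOp_apply (S : (β → ℝ) →ₗ[ℝ] (β → ℝ)) (f : Site L × β → ℝ) (x : Site L) (b : β) :
    sndOp S f (x, b) = S (fun b => f (x, b)) b := rfl

lemma siteShift_commute_sndOp (d : Site L) (S : (β → ℝ) →ₗ[ℝ] (β → ℝ)) :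
    Commute (siteShift d) (sndOp (L := L) S) := rfl

lemma lineWalk_commute {d : Site L} {X : (Site L × β → ℝ) →L[ℝ] (Site L × β → ℝ)}
    (h : Commute (siteShift d) X) : Commute (lineWalk d) X :=
  (h.add_left (h.pow_left _)).smul_left _

/-- The generator of the pair formed by a random walk on the torus and an independent process with
generator `S - c`. -/
def pairGenerator (S : (β → ℝ) →ₗ[ℝ] (β → ℝ)) (c : ℝ) :
    (Site L × β → ℝ) →L[ℝ] (Site L × β → ℝ) :=
  ((1 / 3 : ℝ) • (lineWalk (1, 0) + lineWalk (0, 1) + lineWalk (-1, 1)) + sndOp S) - (1 + c) • 1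

lemma pairGenerator_apply (S : (β → ℝ) →ₗ[ℝ] (β → ℝ)) (c : ℝ) (f : Site L × β → ℝ) (x : Site L)
    (b : β) : pairGenerator S c f (x, b) =
      ∑ d, (f (x + latticeDir L d, b) - f (x, b)) / 6 + (S (fun b => f (x, b)) b - c * f (x, b)) := by
  have h : pairGenerator S c f (x, b) = 1 / 3 * (lineWalk (1, 0) f (x, b) + lineWalk (0, 1) f (x, b)
    + lineWalk (-1, 1) f (x, b)) + S (fun b => f (x, b)) b - (1 + c) * f (x, b) := rfl
  rw [h, lineWalk_apply, lineWalk_apply, lineWalk_apply, Fin.sum_univ_six]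
  simp only [latticeDir, Matrix.cons_val, Prod.neg_mk, neg_zero, neg_neg]
  ring

lemma lineWalk_pos (d : Site L) :
    IsPositiveOp (lineWalk d : (Site L × β → ℝ) →L[ℝ] (Site L × β → ℝ)) :=
  ((siteShift_pos d).add ((siteShift_pos d).pow _)).smul (by norm_num)

lemma exp_pairGenerator_pos {S : (β → ℝ) →ₗ[ℝ] (β → ℝ)} (hS : ∀ f, 0 ≤ f → 0 ≤ S f) (c : ℝ) {t : ℝ}
    (ht : 0 ≤ t) : IsPositiveOp (NormedSpace.exp (t • pairGenerator (L := L) S c)) := by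
  refine IsPositiveOp.exp_sub (IsPositiveOp.add ?_ ?_) _ ht
  · exact (((lineWalk_pos _).add (lineWalk_pos _)).add (lineWalk_pos _)).smul (by norm_num)
  · intro f hf p
    exact hS _ (fun b => hf (p.1, b)) p.2

lemma siteAverage_commute_pairGenerator (S : (β → ℝ) →ₗ[ℝ] (β → ℝ)) (c : ℝ) :
    Commute siteAverage (pairGenerator (L := L) S c) := by
  have h1 : ∀ d : Site L, Commute (siteAverage : (Site L × β → ℝ) →L[ℝ] (Site L × β → ℝ))
      (lineWalk d) := fun d => (lineWalk_commute (siteShift_commute_siteAverage d)).symm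
  have h2 : Commute siteAverage (sndOp (L := L) S) :=
    (Commute.sum_left _ _ _ fun d _ => siteShift_commute_sndOp d S).smul_left _
  exact (((((h1 _).add_right (h1 _)).add_right (h1 _)).smul_right _).add_right h2).sub_right
    ((Commute.one_right _).smul_right _)

/-- Each pair of directions has determinant 1, hence is a basis for every L. -/
lemma zmod_lines_injective (L : ℕ) :
    (Function.Injective fun p : ZMod L × ZMod L => p.1 • ((1, 0) : Site L) + p.2 • (0, 1)) ∧
    (Function.Injective fun p : ZMod L × ZMod L => p.1 • ((1, 0) : Site L) + p.2 • (-1, 1)) ∧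
    (Function.Injective fun p : ZMod L × ZMod L => p.1 • ((0, 1) : Site L) + p.2 • (-1, 1)) := by
  refine ⟨?_, ?_, ?_⟩ <;> rintro ⟨a, b⟩ ⟨a', b'⟩ h <;> simp at h ⊢ <;> grind

/-- The line walks commute with one another and with the operator on the second coordinate, so the
exponential factors. The weight 1/3 of each direction turns the time 2L²/5 into 2L²/15. -/
lemma exp_pairGenerator_eq (S : (β → ℝ) →ₗ[ℝ] (β → ℝ)) (c : ℝ) :
    NormedSpace.exp ((2 / 5 * (L : ℝ) ^ 2) • pairGenerator (L := L) S c) =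
      ((73 / 100 : ℝ) • lineAverage (1, 0) + lineRest (1, 0)) *
        ((73 / 100 : ℝ) • lineAverage (0, 1) + lineRest (0, 1)) *
        ((73 / 100 : ℝ) • lineAverage (-1, 1) + lineRest (-1, 1)) *
        NormedSpace.exp ((2 / 5 * (L : ℝ) ^ 2) • (sndOp S - c • 1)) := by
  let _ : NormedAlgebra ℚ ((Site L × β → ℝ) →L[ℝ] (Site L × β → ℝ)) :=
    NormedAlgebra.restrictScalars ℚ ℝ _
  have hW : ∀ d e : Site L, Commute ((2 * (L : ℝ) ^ 2 / 15) •
      (lineWalk d - 1 : (Site L × β → ℝ) →L[ℝ] (Site L × β → ℝ)))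
      ((2 * (L : ℝ) ^ 2 / 15) • (lineWalk e - 1)) := fun d e =>
    ((((lineWalk_commute (lineWalk_commute (siteShift_comm e d)).symm).sub_left
      (Commute.one_left _)).sub_right (Commute.one_right _)).smul_left _).smul_right _
  have hB : ∀ d : Site L, Commute ((2 * (L : ℝ) ^ 2 / 15) •
      (lineWalk d - 1 : (Site L × β → ℝ) →L[ℝ] (Site L × β → ℝ)))
      ((2 / 5 * (L : ℝ) ^ 2) • (sndOp S - c • 1)) := fun d =>
    ((((lineWalk_commute (siteShift_commute_sndOp d S)).sub_left (Commute.one_left _)).sub_right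
      ((Commute.one_right _).smul_right _)).smul_left _).smul_right _
  rw [← exp_lineWalk, ← exp_lineWalk, ← exp_lineWalk, ← NormedSpace.exp_add_of_commute (hW _ _),
    ← NormedSpace.exp_add_of_commute ((hW _ _).add_left (hW _ _)),
    ← NormedSpace.exp_add_of_commute (((hB _).add_left (hB _)).add_left (hB _))]
  congr 1
  rw [pairGenerator]
  module

/-- A bounded potential for the pair formed by a random walk on the torus and an independent moving
set of sites, whose drift is positive as long as the walk has not met the moving set. -/
theorem exists_pair_potential (hL : 3 ≤ L) (S : (β → ℝ) →ₗ[ℝ] (β → ℝ))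
    (hS : ∀ f, 0 ≤ f → 0 ≤ S f) (c : ℝ) (hS1 : S 1 = c • 1) (A : β → Finset (Site L)) (a : ℕ)
    (hA : ∀ b, (A b).card = a) :
    ∃ h : Site L → β → ℝ, (∀ x b, 0 ≤ h x b) ∧ (∀ x b, h x b ≤ 2 / 5 * (L : ℝ) ^ 2) ∧
      (∀ b, ∑ x, h x b = 2 / 5 * (L : ℝ) ^ 2 * a) ∧
      ∀ x b, x ∉ A b → 8206 / 10000 * (a / (L : ℝ) ^ 2) ≤
        ∑ d, (h (x + latticeDir L d) b - h x b) / 6 + (S (h x) b - c * h x b) := by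
  classical
  set T : ℝ := 2 / 5 * (L : ℝ) ^ 2 with hT
  have hT0 : 0 ≤ T := by positivity
  have hL0 : (L : ℝ) ≠ 0 := NeZero.ne _
  set Q : (Site L × β → ℝ) →L[ℝ] (Site L × β → ℝ) := pairGenerator S c with hQ
  -- The indicator that the walk lies in the moving set. The potential is the integral over [0, T]
  -- of its evolution `g`.
  let g₀ : Site L × β → ℝ := fun p => if p.1 ∈ A p.2 then 1 else 0
  have hg₀ : 0 ≤ g₀ := fun p => by simp only [g₀]; split_ifs <;> simp
  have hg₁ : g₀ ≤ 1 := fun p => by simp only [g₀]; split_ifs <;> simp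
  have hQ1 : Q 1 = 0 := by
    ext ⟨x, b⟩
    rw [hQ, pairGenerator_apply]
    have : S (fun _ => 1) b = c := by
      exact (congrFun hS1 b).trans (mul_one c)
    simp [this]
  have hU0 : siteAverage g₀ = (a / (L : ℝ) ^ 2 : ℝ) • (1 : Site L × β → ℝ) := by
    ext ⟨x, b⟩
    rw [siteAverage_apply]
    simp only [g₀, Finset.sum_ite_mem, Finset.univ_inter, Finset.sum_const, hA]
    simp; ring
  let g : ℝ → Site L × β → ℝ := fun t => NormedSpace.exp (t • Q) g₀
  have hexp1 : ∀ t : ℝ, NormedSpace.exp (t • Q) 1 = 1 := fun t =>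
    exp_apply_of_apply_eq_zero (by rw [smul_apply, hQ1, smul_zero])
  have hpos : ∀ t : ℝ, 0 ≤ t → IsPositiveOp (NormedSpace.exp (t • Q)) := fun t ht =>
    exp_pairGenerator_pos hS c ht
  have hg0 : ∀ t, 0 ≤ t → 0 ≤ g t := fun t ht => hpos t ht _ hg₀
  have hg1 : ∀ t, 0 ≤ t → g t ≤ 1 := fun t ht => by
    rw [← hexp1 t]; exact (hpos t ht).mono hg₁
  have hcomm : ∀ t : ℝ, Commute siteAverage (NormedSpace.exp (t • Q)) := fun t =>
    ((siteAverage_commute_pairGenerator S c).smul_right t).exp_right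
  -- The average over sites of `g₀` is a/L² for every `b`, because all sets have the same size. It
  -- commutes with the dynamics, so it is conserved and no mixing of the moving set is needed.
  have hgU : ∀ t, siteAverage (g t) = (a / (L : ℝ) ^ 2 : ℝ) • (1 : Site L × β → ℝ) := fun t => by
    have : siteAverage (g t) = NormedSpace.exp (t • Q) (siteAverage g₀) :=
      DFunLike.congr_fun (hcomm t).eq g₀
    rw [this, hU0, map_smul, hexp1]
  have hgsum : ∀ t b, ∑ x, g t (x, b) = a := fun t b => by
    have := congrFun (hgU t) (0, b)
    rw [siteAverage_apply] at this
    simp only [Pi.smul_apply, Pi.one_apply, smul_eq_mul, mul_one] at this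
    field_simp at this
    exact this
  have hderiv : ∀ t, HasDerivAt g (Q (g t)) t := fun t => by
    have h1 := hasDerivAt_exp_smul_const' (𝕂 := ℝ) Q t
    exact (ContinuousLinearMap.apply ℝ _ g₀).hasFDerivAt.comp_hasDerivAt t h1
  have hcont : Continuous g := continuous_iff_continuousAt.2 fun t => (hderiv t).continuousAt
  have hint : IntervalIntegrable g volume 0 T := hcont.intervalIntegrable _ _
  have hcomp : ∀ p, (∫ t in (0 : ℝ)..T, g t) p = ∫ t in (0 : ℝ)..T, g t p := fun p =>
    ((ContinuousLinearMap.proj (R := ℝ) (φ := fun _ : Site L × β => ℝ) p).intervalIntegral_comp_comm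
      hint).symm
  have hcp : ∀ p, Continuous fun t => g t p := fun p => (continuous_apply p).comp hcont
  refine ⟨fun x b => (∫ t in (0 : ℝ)..T, g t) (x, b), ?_, ?_, ?_, ?_⟩
  · intro x b
    beta_reduce
    rw [hcomp]
    exact intervalIntegral.integral_nonneg hT0 fun t ht => hg0 t ht.1 _
  · intro x b
    beta_reduce
    rw [hcomp]
    calc _ ≤ ∫ t in (0 : ℝ)..T, (1 : ℝ) :=
          intervalIntegral.integral_mono_on hT0 ((hcp _).intervalIntegrable _ _)
            (by simp) fun t ht => hg1 t ht.1 _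
      _ = T := by simp
  · intro b
    simp only [hcomp]
    rw [← intervalIntegral.integral_finsetSum fun x _ => (hcp _).intervalIntegrable _ _]
    simp [hgsum]
  · intro x b hx
    rw [← pairGenerator_apply S c (∫ t in (0 : ℝ)..T, g t)]
    -- The generator applied to the time integral is the increment of the semigroup, by the
    -- fundamental theorem of calculus.
    have h1 : Q (∫ t in (0 : ℝ)..T, g t) = g T - g 0 := by
      rw [← Q.intervalIntegral_comp_comm hint]
      exact intervalIntegral.integral_eq_sub_of_hasDerivAt (fun t _ => hderiv t)
        ((Q.continuous.comp hcont).intervalIntegrable _ _)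
    have h2 : g 0 (x, b) = 0 := by simp [g, g₀, hx]
    have h3 : g T = (((73 / 100 : ℝ) • lineAverage (1, 0) + lineRest (1, 0)) *
        ((73 / 100 : ℝ) • lineAverage (0, 1) + lineRest (0, 1)) *
        ((73 / 100 : ℝ) • lineAverage (-1, 1) + lineRest (-1, 1)) :
          (Site L × β → ℝ) →L[ℝ] (Site L × β → ℝ))
        (NormedSpace.exp (T • (sndOp S - c • 1)) g₀) := by
      simp only [g, hQ, hT, exp_pairGenerator_eq]
      rfl
    -- The evolution of the moving set is applied first: `φ` is nonnegative with site average a/L²,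
    -- which is all that the heat kernel bound asks for.
    set φ := NormedSpace.exp (T • (sndOp (L := L) S - c • 1)) g₀ with hφ
    have hφ0 : 0 ≤ φ := IsPositiveOp.exp_sub
      (fun f hf p => hS _ (fun b => hf (p.1, b)) p.2) c hT0 _ hg₀
    have hφU : siteAverage φ = (a / (L : ℝ) ^ 2 : ℝ) • (1 : Site L × β → ℝ) := by
      have hc : Commute siteAverage (NormedSpace.exp (T • (sndOp (L := L) S - c • 1))) := by
        refine Commute.exp_right (Commute.smul_right (Commute.sub_right ?_
          ((Commute.one_right _).smul_right _)) _)
        exact (Commute.sum_left _ _ _ fun d _ => siteShift_commute_sndOp d S).smul_left _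
      have : siteAverage φ = NormedSpace.exp (T • (sndOp (L := L) S - c • 1)) (siteAverage g₀) :=
        DFunLike.congr_fun hc.eq g₀
      rw [this, hU0, map_smul, exp_apply_of_apply_eq_zero]
      ext ⟨x, b⟩
      have : S (fun _ => 1) b = c := by
        exact (congrFun hS1 b).trans (mul_one c)
      simp [sndOp_apply, this]
    obtain ⟨i12, i13, i23⟩ := zmod_lines_injective L
    have h4 := torus_heat_lower_bound hL i12 i13 i23 hφ0 (x, b)
    rw [← h3, hφU] at h4
    rw [← hQ, h1]
    simpa [h2] using h4

end Potential

/-! ### Finite expectations. -/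

section PMFMean

variable {α β : Type*} [Fintype α] [Fintype β]

/-- The expectation of a real function under a probability mass function on a finite type. -/
def pmfMean (p : PMF α) (f : α → ℝ) : ℝ := ∑ x, (p x).toReal * f x

lemma pmfMean_pure (a : α) (f : α → ℝ) : pmfMean (PMF.pure a) f = f a := by
  classical
  rw [pmfMean, Finset.sum_eq_single a]
  · simp
  · intro b _ hb; simp [PMF.pure_apply, hb]
  · simp

lemma pmfMean_bind (p : PMF α) (q : α → PMF β) (f : β → ℝ) :
    pmfMean (p.bind q) f = pmfMean p fun a => pmfMean (q a) f := by
  simp only [pmfMean, PMF.bind_apply, tsum_fintype, Finset.mul_sum]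
  rw [Finset.sum_comm]
  refine Finset.sum_congr rfl fun b _ => ?_
  rw [ENNReal.toReal_sum fun a _ => ENNReal.mul_ne_top (p.apply_ne_top a) ((q a).apply_ne_top b),
    Finset.sum_mul]
  refine Finset.sum_congr rfl fun a _ => ?_
  rw [ENNReal.toReal_mul, mul_assoc]

lemma pmfMean_map (p : PMF α) (g : α → β) (f : β → ℝ) :
    pmfMean (p.map g) f = pmfMean p fun a => f (g a) := by
  rw [PMF.map, pmfMean_bind]
  simp only [Function.comp_apply, pmfMean_pure]

lemma pmfMean_uniform [Nonempty α] (f : α → ℝ) :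
    pmfMean (PMF.uniformOfFintype α) f = (∑ x, f x) / Fintype.card α := by
  simp [pmfMean, ← Finset.mul_sum, div_eq_inv_mul]

lemma sum_toReal_pmf (p : PMF α) : ∑ x, (p x).toReal = 1 := by
  rw [← ENNReal.toReal_sum fun a _ => p.apply_ne_top a, ← tsum_fintype (L := .unconditional α),
    p.tsum_coe, ENNReal.toReal_one]

lemma pmfMean_const (p : PMF α) (c : ℝ) : pmfMean p (fun _ => c) = c := by
  rw [pmfMean, ← Finset.sum_mul, sum_toReal_pmf, one_mul]

lemma pmfMean_mono (p : PMF α) {f g : α → ℝ} (h : ∀ x, f x ≤ g x) : pmfMean p f ≤ pmfMean p g :=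
  Finset.sum_le_sum fun x _ => mul_le_mul_of_nonneg_left (h x) ENNReal.toReal_nonneg

lemma pmfMean_add (p : PMF α) (f g : α → ℝ) :
    pmfMean p (fun x => f x + g x) = pmfMean p f + pmfMean p g := by
  simp only [pmfMean, mul_add, Finset.sum_add_distrib]

lemma pmfMean_sub (p : PMF α) (f g : α → ℝ) :
    pmfMean p (fun x => f x - g x) = pmfMean p f - pmfMean p g := by
  simp only [pmfMean, mul_sub, Finset.sum_sub_distrib]

lemma pmfMean_const_mul (p : PMF α) (c : ℝ) (f : α → ℝ) :
    pmfMean p (fun x => c * f x) = c * pmfMean p f := by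
  simp only [pmfMean, Finset.mul_sum]
  exact Finset.sum_congr rfl fun x _ => by ring

lemma pmfMean_sum {κ : Type*} (s : Finset κ) (p : PMF α) (f : κ → α → ℝ) :
    pmfMean p (fun x => ∑ k ∈ s, f k x) = ∑ k ∈ s, pmfMean p (f k) := by
  simp only [pmfMean, Finset.mul_sum]
  exact Finset.sum_comm

lemma pmfMean_congr_support (p : PMF α) {f g : α → ℝ} (h : ∀ x ∈ p.support, f x = g x) :
    pmfMean p f = pmfMean p g := by
  refine Finset.sum_congr rfl fun x _ => ?_
  by_cases hx : x ∈ p.support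
  · rw [h x hx]
  · rw [PMF.mem_support_iff, not_not] at hx
    simp [hx]

end PMFMean

/-! ### Single activations: survival of contacts, and decoupling without contacts. -/

section Movement

variable {V : Type} [Fintype V] [DecidableEq V] {L : ℕ}

/-- The activation of the agent `u` in a movement step. -/
def agentStep (lam : ℝ) (σ : V → BehaviorGroup) (c : LatticeConfig V L) (u : V) :
    PMF (LatticeConfig V L) :=
  match σ u with
  | .immobile => PMF.pure c
  | .mobile => executeGather lam σ c u
  | .unaware => executeSearch c u

omit [Fintype V] in
lemma agentStep_immobile (lam : ℝ) {σ : V → BehaviorGroup} (c : LatticeConfig V L) {u : V}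
    (h : σ u = .immobile) : agentStep lam σ c u = PMF.pure c := by
  unfold agentStep; rw [h]

omit [Fintype V] in
lemma agentStep_mobile (lam : ℝ) {σ : V → BehaviorGroup} (c : LatticeConfig V L) {u : V}
    (h : σ u = .mobile) : agentStep lam σ c u = executeGather lam σ c u := by
  unfold agentStep; rw [h]

omit [Fintype V] in
lemma agentStep_unaware (lam : ℝ) {σ : V → BehaviorGroup} (c : LatticeConfig V L) {u : V}
    (h : σ u = .unaware) : agentStep lam σ c u = executeSearch c u := by
  unfold agentStep; rw [h]

lemma movementStep_eq [Nonempty V] (lam : ℝ) (σ : V → BehaviorGroup) (c : LatticeConfig V L) :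
    movementStep lam σ c = (PMF.uniformOfFintype V).bind (agentStep lam σ c) := rfl

instance [NeZero L] : Fintype (LatticeConfig V L) := Fintype.ofFinite _

omit [Fintype V] in
lemma moveAgent_of_ne (c : LatticeConfig V L) {u v : V} {ℓ : Site L} (h : ∀ v, c v ≠ ℓ)
    (hv : v ≠ u) : moveAgent c u ℓ h v = c v := Function.update_of_ne hv _ _

omit [Fintype V] in
lemma moveAgent_self (c : LatticeConfig V L) {u : V} {ℓ : Site L} (h : ∀ v, c v ≠ ℓ) :
    moveAgent c u ℓ h u = ℓ := Function.update_self _ _ _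

omit [Fintype V] in
/-- The activation of an agent does not move the other agents. -/
lemma agentStep_support {lam : ℝ} {σ : V → BehaviorGroup} {c c' : LatticeConfig V L} {u v : V}
    (hc' : c' ∈ (agentStep lam σ c u).support) (hv : v ≠ u) : c' v = c v := by
  classical
  unfold agentStep at hc'
  split at hc'
  · simp at hc'; rw [hc']
  · unfold executeGather at hc'
    rw [PMF.mem_support_bind_iff] at hc'
    obtain ⟨d, _, hd⟩ := hc'
    split_ifs at hd with h
    · rw [PMF.mem_support_map_iff] at hd
      obtain ⟨b, _, rfl⟩ := hd
      cases b
      · rfl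
      · exact moveAgent_of_ne c h.1 hv
    · simp at hd; rw [hd]
  · unfold executeSearch at hc'
    rw [PMF.mem_support_map_iff] at hc'
    obtain ⟨d, _, rfl⟩ := hc'
    split_ifs with h
    · exact moveAgent_of_ne c h hv
    · rfl

/-- Some Unaware agent is adjacent to an Aware agent. -/
def HasContact (σ : V → BehaviorGroup) (c : LatticeConfig V L) : Prop :=
  ∃ u v, σ u = .unaware ∧ σ v ≠ .unaware ∧ (contactGraph c).Adj u v

omit [DecidableEq V] in
lemma HasContact.one_le_activeCount {σ : V → BehaviorGroup} {c : LatticeConfig V L}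
    (h : HasContact σ c) : 1 ≤ activeCount σ (contactGraph c) := by
  obtain ⟨u, v, hu, hv, huv⟩ := h
  exact (Set.ncard_pos (Set.toFinite _)).2 ⟨u, hu, v, huv, hv⟩

open Classical in
/-- A movement step destroys all contacts with probability at most `2 / n`. -/
lemma movementStep_keeps_contact [Nonempty V] [NeZero L] (lam : ℝ) {σ : V → BehaviorGroup}
    {c : LatticeConfig V L} (h : HasContact σ c) :
    pmfMean (movementStep lam σ c) (fun c' => if HasContact σ c' then 0 else 1) ≤
      2 / Fintype.card V := by
  obtain ⟨u, w, hu, hw, huw⟩ := h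
  rw [movementStep_eq, pmfMean_bind, pmfMean_uniform]
  refine div_le_div_of_nonneg_right ?_ (by positivity)
  -- A fixed contact pair stays adjacent unless one of its two members is the activated agent.
  have key : ∀ v, pmfMean (agentStep lam σ c v) (fun c' => if HasContact σ c' then 0 else 1) ≤
      (if v = u then 1 else 0) + (if v = w then 1 else 0) := by
    intro v
    have hle : pmfMean (agentStep lam σ c v) (fun c' => if HasContact σ c' then 0 else 1) ≤ 1 := by
      calc _ ≤ pmfMean (agentStep lam σ c v) (fun _ => 1) :=
            pmfMean_mono _ fun x => by split_ifs <;> norm_num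
        _ = 1 := pmfMean_const _ _
    by_cases h1 : v = u
    · rw [if_pos h1]; split_ifs <;> linarith
    by_cases h2 : v = w
    · rw [if_neg h1, if_pos h2]; linarith
    have hkeep : ∀ c' ∈ (agentStep lam σ c v).support,
        (if HasContact σ c' then (0 : ℝ) else 1) = 0 := by
      intro c' hc'
      refine if_pos ⟨u, w, hu, hw, ?_⟩
      change (triangularLattice L).Adj (c' u) (c' w)
      rw [agentStep_support hc' (Ne.symm h1), agentStep_support hc' (Ne.symm h2)]
      exact huw
    rw [if_neg h1, if_neg h2, pmfMean_congr_support (g := fun _ => 0) _ hkeep, pmfMean_const,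
      add_zero]
  refine (Finset.sum_le_sum fun v _ => key v).trans ?_
  rw [Finset.sum_add_distrib]
  norm_num

/-- The configuration of the Aware agents. -/
def awarePart (σ : V → BehaviorGroup) (c : LatticeConfig V L) :
    LatticeConfig {v // σ v ≠ .unaware} L :=
  (Function.Embedding.subtype _).trans c

omit [Fintype V] [DecidableEq V] in
lemma awareNbrs_awarePart (σ : V → BehaviorGroup) (c : LatticeConfig V L)
    (w : {v // σ v ≠ .unaware}) (ℓ : Site L) :
    awareNbrs (fun v : {v // σ v ≠ .unaware} => σ v) (awarePart σ c) w ℓ = awareNbrs σ c w ℓ := by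
  ext y
  simp only [awareNbrs, Set.mem_ofPred_eq, awarePart]
  refine and_congr_right fun _ => ⟨?_, ?_⟩
  · rintro ⟨v, h1, h2, h3⟩
    exact ⟨v, fun h => h1 (Subtype.ext h), h2, h3⟩
  · rintro ⟨v, h1, h2, h3⟩
    exact ⟨⟨v, h2⟩, fun h => h1 (congrArg Subtype.val h), h2, h3⟩

omit [Fintype V] in
lemma awarePart_moveAgent_aware (σ : V → BehaviorGroup) (c : LatticeConfig V L)
    (w : {v // σ v ≠ .unaware}) {ℓ : Site L} (h : ∀ v, c v ≠ ℓ)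
    (h' : ∀ v, awarePart σ c v ≠ ℓ) :
    awarePart σ (moveAgent c w ℓ h) = moveAgent (awarePart σ c) w ℓ h' := by
  ext1 v
  by_cases hv : v = w
  · subst hv
    rw [moveAgent_self]
    exact moveAgent_self c h
  · rw [moveAgent_of_ne _ _ hv]
    exact moveAgent_of_ne c h fun h => hv (Subtype.ext h)

omit [Fintype V] in
lemma awarePart_moveAgent_unaware (σ : V → BehaviorGroup) (c : LatticeConfig V L) {u : V}
    (hu : σ u = .unaware) {ℓ : Site L} (h : ∀ v, c v ≠ ℓ) :
    awarePart σ (moveAgent c u ℓ h) = awarePart σ c := by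
  ext1 v
  exact moveAgent_of_ne c h fun e => v.2 ((congrArg σ e).trans hu)

omit [Fintype V] [DecidableEq V] in
/-- Without contacts, the neighboring sites of an agent are not occupied by agents of the other
kind. -/
lemma unaware_iff_of_neighbor {σ : V → BehaviorGroup} {c : LatticeConfig V L}
    (hc : ¬ HasContact σ c) {v w : V} {d : Fin 6} (h : c w = c v + latticeDir L d) :
    σ w = .unaware ↔ σ v = .unaware := by
  by_contra hne
  have hvw : v ≠ w := by rintro rfl; exact hne Iff.rfl
  have hadj : (contactGraph c).Adj v w := ⟨fun e => hvw (c.injective e), d, h⟩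
  by_cases hw : σ w = .unaware
  · exact hc ⟨w, v, hw, fun e => hne ⟨fun _ => e, fun _ => hw⟩, hadj.symm⟩
  · exact hc ⟨v, w, by tauto, hw, hadj⟩

-- A move could be invalid in the full system but valid among Aware agents only if an Unaware agent
-- blocked the target; that agent would be in contact with the mover.
omit [Fintype V] [DecidableEq V] in
lemma validCompressionMove_awarePart {σ : V → BehaviorGroup} {c : LatticeConfig V L}
    (hc : ¬ HasContact σ c) (w : {v // σ v ≠ .unaware}) (d : Fin 6) :
    ValidCompressionMove (fun v : {v // σ v ≠ .unaware} => σ v) (awarePart σ c) w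
      (awarePart σ c w + latticeDir L d) ↔ ValidCompressionMove σ c w (c w + latticeDir L d) := by
  unfold ValidCompressionMove
  rw [awareNbrs_awarePart, awareNbrs_awarePart]
  refine and_congr ⟨fun h v hv => ?_, fun h v => h v⟩ Iff.rfl
  have := (unaware_iff_of_neighbor hc hv).not
  exact h ⟨v, this.2 w.2⟩ hv

/-- Sum of a function of the site and of the Aware configuration over the Unaware agents. -/
def unawareSum (σ : V → BehaviorGroup)
    (h : Site L → LatticeConfig {v // σ v ≠ .unaware} L → ℝ) (c : LatticeConfig V L) : ℝ :=
  ∑ u with σ u = .unaware, h (c u) (awarePart σ c)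

lemma unawareSum_moveAgent_aware {σ : V → BehaviorGroup}
    (h : Site L → LatticeConfig {v // σ v ≠ .unaware} L → ℝ) (c : LatticeConfig V L)
    (w : {v // σ v ≠ .unaware}) {ℓ : Site L} (hℓ : ∀ v, c v ≠ ℓ)
    (hℓ' : ∀ v, awarePart σ c v ≠ ℓ) :
    unawareSum σ h (moveAgent c w ℓ hℓ) =
      ∑ u with σ u = .unaware, h (c u) (moveAgent (awarePart σ c) w ℓ hℓ') := by
  unfold unawareSum
  rw [awarePart_moveAgent_aware]
  refine Finset.sum_congr rfl fun u hu => ?_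
  rw [Finset.mem_filter] at hu
  rw [moveAgent_of_ne]
  rintro rfl
  exact w.2 hu.2

lemma unawareSum_moveAgent_unaware {σ : V → BehaviorGroup}
    (h : Site L → LatticeConfig {v // σ v ≠ .unaware} L → ℝ) (c : LatticeConfig V L) {u : V}
    (hu : σ u = .unaware) {ℓ : Site L} (hℓ : ∀ v, c v ≠ ℓ) :
    unawareSum σ h (moveAgent c u ℓ hℓ) - unawareSum σ h c =
      h ℓ (awarePart σ c) - h (c u) (awarePart σ c) := by
  unfold unawareSum
  rw [awarePart_moveAgent_unaware σ c hu, ← Finset.sum_sub_distrib, Finset.sum_eq_single u]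
  · rw [moveAgent_self]
  · intro v _ hv
    rw [moveAgent_of_ne _ _ hv, sub_self]
  · simp [hu]

/-- Without contacts, an Aware agent moves as if there were no Unaware agents. -/
lemma pmfMean_agentStep_aware [NeZero L] (lam : ℝ) {σ : V → BehaviorGroup}
    (h : Site L → LatticeConfig {v // σ v ≠ .unaware} L → ℝ) {c : LatticeConfig V L}
    (hc : ¬ HasContact σ c) (w : {v // σ v ≠ .unaware}) :
    pmfMean (agentStep lam σ c w) (unawareSum σ h) =
      ∑ u with σ u = .unaware, pmfMean
        (agentStep lam (fun v : {v // σ v ≠ .unaware} => σ v) (awarePart σ c) w) (h (c u)) := by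
  classical
  rw [← pmfMean_sum]
  rcases hw : σ w with _ | _ | _
  · exact absurd hw w.2
  · rw [agentStep_mobile lam c hw, agentStep_mobile (σ := fun v : {v // σ v ≠ .unaware} => σ v) lam _ hw]
    unfold executeGather
    rw [pmfMean_bind, pmfMean_bind]
    congr 1
    funext d
    have hv := validCompressionMove_awarePart hc w d
    by_cases hd : ValidCompressionMove σ c w (c w + latticeDir L d)
    · rw [dif_pos hd, dif_pos (hv.2 hd), pmfMean_map, pmfMean_map]
      have e1 := awareNbrs_awarePart σ c w (c w + latticeDir L d)
      have e2 := awareNbrs_awarePart σ c w (c w)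
      have e3 : awarePart σ c w = c w := rfl
      simp only [e3, e1, e2]
      congr 1
      funext b
      cases b
      · rfl
      · exact unawareSum_moveAgent_aware h c w hd.1 (hv.2 hd).1
    · rw [dif_neg hd, dif_neg (fun h => hd (hv.1 h)), pmfMean_pure, pmfMean_pure]
      rfl
  · rw [agentStep_immobile lam c hw, 
      agentStep_immobile (σ := fun v : {v // σ v ≠ .unaware} => σ v) lam _ hw, pmfMean_pure, pmfMean_pure]
    rfl

-- The first sum is the free walk, the second subtracts the blocked moves. Without contacts the
-- blocking agent is itself Unaware, which gives the correction a symmetric range of agents.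
open Classical in
lemma pmfMean_agentStep_unaware [NeZero L] (lam : ℝ) {σ : V → BehaviorGroup}
    (h : Site L → LatticeConfig {v // σ v ≠ .unaware} L → ℝ) {c : LatticeConfig V L}
    (hc : ¬ HasContact σ c) {u : V} (hu : σ u = .unaware) :
    pmfMean (agentStep lam σ c u) (unawareSum σ h) - unawareSum σ h c =
      ∑ d, (h (c u + latticeDir L d) (awarePart σ c) - h (c u) (awarePart σ c)) / 6 -
      ∑ d, ∑ v with σ v = .unaware, if c v = c u + latticeDir L d then
        (h (c v) (awarePart σ c) - h (c u) (awarePart σ c)) / 6 else 0 := by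
  have e : pmfMean (agentStep lam σ c u) (unawareSum σ h) - unawareSum σ h c =
      pmfMean (agentStep lam σ c u) fun x => unawareSum σ h x - unawareSum σ h c := by
    rw [pmfMean_sub, pmfMean_const]
  rw [e, agentStep_unaware lam c hu]
  unfold executeSearch
  rw [pmfMean_map, pmfMean_uniform, Fintype.card_fin, Finset.sum_div, ← Finset.sum_sub_distrib]
  refine Finset.sum_congr rfl fun d _ => ?_
  by_cases hd : ∀ v, c v ≠ c u + latticeDir L d
  · rw [dif_pos hd, unawareSum_moveAgent_unaware h c hu, Finset.sum_eq_zero, sub_zero]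
    · norm_num
    · intro v _; rw [if_neg (hd v)]
  · rw [dif_neg hd, sub_self, zero_div]
    push Not at hd
    obtain ⟨v, hv⟩ := hd
    rw [Finset.sum_eq_single v]
    · rw [if_pos hv, hv, sub_self]
    · intro v' _ hne
      rw [if_neg]
      intro hv'
      exact hne (c.injective (hv'.trans hv.symm))
    · intro hn
      exact absurd (by simpa using (unaware_iff_of_neighbor hc hv).2 hu) hn

-- Exchanging the two agents and reversing the direction is an involution on the terms that flips
-- their sign, so the sum equals its own negative.
omit [Fintype V] [DecidableEq V] in
lemma exclusion_terms_cancel (c : LatticeConfig V L) [DecidableEq (Site L)] (s : Finset V)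
    (f : Site L → ℝ) :
    ∑ u ∈ s, ∑ d, ∑ v ∈ s, (if c v = c u + latticeDir L d then (f (c v) - f (c u)) / 6 else 0)
      = 0 := by
  have key : ∑ u ∈ s, ∑ d, ∑ v ∈ s, (if c v = c u + latticeDir L d then
      (f (c v) - f (c u)) / 6 else 0) = -∑ u ∈ s, ∑ d, ∑ v ∈ s,
        (if c v = c u + latticeDir L d then (f (c v) - f (c u)) / 6 else 0) := by
    have h1 : ∀ u, ∑ d, ∑ v ∈ s, (if c v = c u + latticeDir L d then
        (f (c v) - f (c u)) / 6 else 0) = ∑ v ∈ s, ∑ d, (if c v = c u + latticeDir L d then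
        (f (c v) - f (c u)) / 6 else 0) := fun u => Finset.sum_comm
    simp only [h1]
    conv_lhs => rw [Finset.sum_comm]
    simp only [← Finset.sum_neg_distrib]
    refine Finset.sum_congr rfl fun u _ => Finset.sum_congr rfl fun v _ => ?_
    rw [← Equiv.sum_comp (Equiv.addRight (3 : Fin 6)) fun d =>
      if c u = c v + latticeDir L d then (f (c u) - f (c v)) / 6 else 0]
    refine Finset.sum_congr rfl fun d _ => ?_
    rw [Equiv.coe_addRight, latticeDir_add_three]
    have : c u = c v + -latticeDir L d ↔ c v = c u + latticeDir L d := by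
      constructor <;> intro h <;> rw [h] <;> abel
    simp only [this]
    split_ifs <;> ring
  linarith

end Movement

/-! ### The drift of the potential per movement step and per iteration. -/

section Drift

variable {V : Type} [Fintype V] [DecidableEq V] {L : ℕ}

/-- The drift of `unawareSum` in one movement step without contacts. -/
lemma movementStep_drift [Nonempty V] [NeZero L] (lam : ℝ) {σ : V → BehaviorGroup}
    (h : Site L → LatticeConfig {v // σ v ≠ .unaware} L → ℝ) {c : LatticeConfig V L}
    (hc : ¬ HasContact σ c) :
    pmfMean (movementStep lam σ c) (unawareSum σ h) - unawareSum σ h c =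
      (∑ u with σ u = .unaware,
        (∑ d, (h (c u + latticeDir L d) (awarePart σ c) - h (c u) (awarePart σ c)) / 6 +
        ((∑ w, pmfMean (agentStep lam (fun v : {v // σ v ≠ .unaware} => σ v) (awarePart σ c) w)
          (h (c u))) -
          (Fintype.card {v // σ v ≠ .unaware} : ℝ) * h (c u) (awarePart σ c)))) /
      Fintype.card V := by
  classical
  have hn : (Fintype.card V : ℝ) ≠ 0 := by exact_mod_cast Fintype.card_ne_zero
  rw [movementStep_eq, pmfMean_bind, pmfMean_uniform]
  have e1 : (∑ u, pmfMean (agentStep lam σ c u) (unawareSum σ h)) / Fintype.card V -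
      unawareSum σ h c = (∑ u, (pmfMean (agentStep lam σ c u) (unawareSum σ h) -
        unawareSum σ h c)) / Fintype.card V := by
    rw [Finset.sum_sub_distrib]
    simp only [Finset.sum_const, Finset.card_univ, nsmul_eq_mul]
    field_simp
  rw [e1]
  congr 1
  rw [← Finset.sum_filter_add_sum_filter_not Finset.univ (fun u => σ u = .unaware)]
  rw [Finset.sum_congr rfl fun u hu =>
    pmfMean_agentStep_unaware lam h hc (Finset.mem_filter.1 hu).2, Finset.sum_sub_distrib,
    exclusion_terms_cancel c _ fun x => h x (awarePart σ c), sub_zero, Finset.sum_add_distrib]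
  congr 1
  have e2 : ∑ u with ¬ σ u = .unaware, (pmfMean (agentStep lam σ c u) (unawareSum σ h) -
      unawareSum σ h c) = ∑ w : {v // σ v ≠ .unaware},
        (pmfMean (agentStep lam σ c w) (unawareSum σ h) - unawareSum σ h c) :=
    Finset.sum_subtype _ (by simp) fun u => (pmfMean (agentStep lam σ c u) (unawareSum σ h) -
      unawareSum σ h c)
  rw [e2]
  have e3 : ∀ w : {v // σ v ≠ .unaware}, pmfMean (agentStep lam σ c w) (unawareSum σ h) -
      unawareSum σ h c = ∑ u with σ u = .unaware, (pmfMean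
        (agentStep lam (fun v : {v // σ v ≠ .unaware} => σ v) (awarePart σ c) w) (h (c u)) -
        h (c u) (awarePart σ c)) := fun w => by
    rw [pmfMean_agentStep_aware lam h hc, Finset.sum_sub_distrib]; rfl
  rw [Finset.sum_congr rfl fun w _ => e3 w, Finset.sum_comm]
  refine Finset.sum_congr rfl fun u _ => ?_
  rw [Finset.sum_sub_distrib]
  simp

-- On the torus with L = 2 any two distinct sites are adjacent, and for L = 1 two agents do not fit.
omit [Fintype V] [DecidableEq V] in
lemma hasContact_of_small [NeZero L] (hL : L < 3) {σ : V → BehaviorGroup}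
    (hu : ∃ u, σ u = .unaware) (hv : ∃ v, σ v = .immobile) (c : LatticeConfig V L) :
    HasContact σ c := by
  obtain ⟨u, hu⟩ := hu
  obtain ⟨v, hv⟩ := hv
  have huv : u ≠ v := by rintro rfl; rw [hu] at hv; cases hv
  refine ⟨u, v, hu, by simp [hv], ?_⟩
  have hne : c u ≠ c v := fun e => huv (c.injective e)
  refine ⟨hne, ?_⟩
  have hL0 : L ≠ 0 := NeZero.ne L
  obtain rfl | rfl : L = 1 ∨ L = 2 := by omega
  · exact absurd (Subsingleton.elim _ _) hne
  · have key : ∀ x y : Site 2, x ≠ y → ∃ d, y = x + latticeDir 2 d := by decide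
    exact key _ _ hne

open Classical in
/-- A bounded potential whose drift under one movement step is at least `1` without contacts and
which decreases by at most `2 ρ / n` otherwise. -/
theorem exists_movement_potential [Nonempty V] [NeZero L] (lam : ℝ) {σ : V → BehaviorGroup}
    (hu : ∃ u, σ u = .unaware) (hv : ∃ v, σ v = .immobile) (c₀ : LatticeConfig V L) :
    ∃ (ρ : ℝ) (F : LatticeConfig V L → ℝ), 0 ≤ ρ ∧
      (Fintype.card V : ℝ) / 2 + 2 * ρ ≤ 2 * (L : ℝ) ^ 4 + 1 ∧
      (∀ c, 0 ≤ F c) ∧ (∀ c, F c ≤ ρ) ∧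
      ∀ c, F c + (if HasContact σ c then -(ρ * (2 / Fintype.card V)) else 1) ≤
        pmfMean (movementStep lam σ c) F := by
  have hn0 : (0 : ℝ) < Fintype.card V := by exact_mod_cast Fintype.card_pos
  have hLpos : (1 : ℝ) ≤ L := by exact_mod_cast NeZero.one_le
  have hcard : (Fintype.card V : ℝ) ≤ (L : ℝ) ^ 2 := by
    have := Fintype.card_le_of_injective c₀ c₀.injective
    rw [Fintype.card_prod, ZMod.card] at this
    rw [sq]; exact_mod_cast this
  rcases Nat.lt_or_ge L 3 with hL | hL
  · refine ⟨0, fun _ => 0, le_rfl, ?_, fun _ => le_rfl, fun _ => le_rfl, fun c => ?_⟩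
    · have : (L : ℝ) ^ 4 = (L : ℝ) ^ 2 * (L : ℝ) ^ 2 := by ring
      nlinarith [one_le_pow₀ hLpos (n := 2)]
    · rw [if_pos (hasContact_of_small hL hu hv c), pmfMean_const]; simp
  set W := {v // σ v ≠ .unaware} with hW
  set a : ℕ := Fintype.card W with ha
  set m : ℕ := (Finset.univ.filter fun u => σ u = .unaware).card with hm
  have ham : (m : ℝ) + a = Fintype.card V := by
    have h1 : a = (Finset.univ.filter fun u => ¬ σ u = .unaware).card :=
      Fintype.card_subtype _
    have h2 := Finset.card_filter_add_card_filter_not (s := (Finset.univ : Finset V))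
      (fun u => σ u = .unaware)
    rw [h1, hm, ← Finset.card_univ]
    exact_mod_cast h2
  have hm1 : (1 : ℝ) ≤ m := by
    obtain ⟨u, hu⟩ := hu
    exact_mod_cast Finset.card_pos.2 ⟨u, by simp [hu]⟩
  have ha1 : (1 : ℝ) ≤ a := by
    obtain ⟨v, hv⟩ := hv
    have : Nonempty W := ⟨⟨v, by simp [hv]⟩⟩
    exact_mod_cast Fintype.card_pos
  -- The sum over Aware agents of their one-activation operators, unnormalized: it maps the constant
  -- 1 to `a`. Each agent thus has rate 1, and the drift of a movement step is this generator
  -- divided by the number of agents.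
  let S : (LatticeConfig W L → ℝ) →ₗ[ℝ] (LatticeConfig W L → ℝ) :=
    { toFun := fun f b => ∑ w, pmfMean (agentStep lam (fun v : W => σ v) b w) f
      map_add' := fun f g => by
        ext b
        simp only [Pi.add_apply, ← Finset.sum_add_distrib, ← pmfMean_add]
        rfl
      map_smul' := fun r f => by
        ext b
        simp only [Pi.smul_apply, smul_eq_mul, RingHom.id_apply, Finset.mul_sum,
          ← pmfMean_const_mul]
        rfl }
  obtain ⟨h, h0, hT, hsum, hdrift⟩ := exists_pair_potential hL S
    (fun f hf b => Finset.sum_nonneg fun w _ => by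
      rw [← pmfMean_const (agentStep lam (fun v : W => σ v) b w) 0]
      exact pmfMean_mono _ hf) a
    (by
      ext b
      change ∑ w, pmfMean (agentStep lam (fun v : W => σ v) b w) (fun _ => 1) = _
      simp [pmfMean_const, ha])
    (fun b => Finset.univ.map b) a (fun b => by simp [ha])
  set G := unawareSum σ h with hG
  set T : ℝ := 2 / 5 * (L : ℝ) ^ 2 with hTdef
  -- Lower bound for the drift of `G`: each of the `m` Unaware agents contributes 0.8206 a/L².
  -- Dividing by `γ` normalizes the drift to 1.
  set γ : ℝ := 8206 / 10000 * (a / (L : ℝ) ^ 2) * m / Fintype.card V with hγ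
  -- Chosen so that ργ = 2T·ma/(m + a).
  set ρ : ℝ := 8000 / 8206 * (L : ℝ) ^ 4 with hρ
  have hγ0 : 0 < γ := by positivity
  have hG0 : ∀ c, 0 ≤ G c := fun c => Finset.sum_nonneg fun u _ => h0 _ _
  have hGm : ∀ c, G c ≤ T * m := fun c => by
    calc _ ≤ ∑ u with σ u = .unaware, T := Finset.sum_le_sum fun u _ => hT _ _
      _ = T * m := by rw [Finset.sum_const, nsmul_eq_mul, mul_comm]
  have hGa : ∀ c, G c ≤ T * a := fun c => by
    rw [← hsum (awarePart σ c)]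
    calc G c = ∑ x ∈ (Finset.univ.filter fun u => σ u = .unaware).map c, h x (awarePart σ c) := by
          rw [Finset.sum_map]; rfl
      _ ≤ _ := Finset.sum_le_sum_of_subset_of_nonneg (Finset.subset_univ _) fun x _ _ => h0 _ _
  -- `G` is at most T·min(m, a): each summand is at most T, and the sum over all sites is Ta. The
  -- minimum is at most the harmonic mean 2ma/(m + a).
  have hGρ : ∀ c, G c ≤ ρ * γ := fun c => by
    have e : ρ * γ = 2 * T * (m * a) / Fintype.card V := by
      rw [hρ, hγ, hTdef]; field_simp; ring
    rw [e, le_div_iff₀ hn0, ← ham]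
    have hT0 : 0 ≤ T := by positivity
    rcases le_total m a with hma | hma
    · have hma' : (m : ℝ) ≤ a := by exact_mod_cast hma
      calc G c * (m + a) ≤ T * m * (m + a) := by gcongr; exact hGm c
        _ ≤ T * m * (2 * a) := by gcongr; linarith
        _ = _ := by ring
    · have hma' : (a : ℝ) ≤ m := by exact_mod_cast hma
      calc G c * (m + a) ≤ T * a * (m + a) := by gcongr; exact hGa c
        _ ≤ T * a * (2 * m) := by gcongr; linarith
        _ = _ := by ring
  have hFle : ∀ c, G c / γ ≤ ρ := fun c => (div_le_iff₀ hγ0).2 (hGρ c)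
  have hρ0 : 0 ≤ ρ := by positivity
  refine ⟨ρ, fun c => if HasContact σ c then ρ else G c / γ, hρ0, ?_, ?_, ?_, ?_⟩
  -- The slack of 2ρ below 2L⁴, together with the 1, absorbs n/2 ≤ L²/2; here L ≥ 3 enters.
  · have hL9 : (9 : ℝ) ≤ (L : ℝ) ^ 2 := by
      have : (3 : ℝ) ≤ L := by exact_mod_cast hL
      nlinarith
    have e : (L : ℝ) ^ 4 = (L : ℝ) ^ 2 * (L : ℝ) ^ 2 := by ring
    rw [hρ, e]
    nlinarith
  · intro c
    beta_reduce
    split_ifs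
    exacts [hρ0, div_nonneg (hG0 c) hγ0.le]
  · intro c
    beta_reduce
    split_ifs
    exacts [le_rfl, hFle c]
  · intro c
    by_cases hc : HasContact σ c
    · simp only [if_pos hc]
      have h1 := movementStep_keeps_contact lam hc
      have h2 : pmfMean (movementStep lam σ c)
          (fun c' => ρ - ρ * (if HasContact σ c' then 0 else 1)) ≤
          pmfMean (movementStep lam σ c) fun c => if HasContact σ c then ρ else G c / γ := by
        refine pmfMean_mono _ fun c' => ?_
        split_ifs
        · simp
        · simpa using div_nonneg (hG0 c') hγ0.le
      rw [pmfMean_sub, pmfMean_const, pmfMean_const_mul] at h2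
      nlinarith [mul_le_mul_of_nonneg_left h1 hρ0]
    · simp only [if_neg hc]
      have h1 : pmfMean (movementStep lam σ c) (fun c' => γ⁻¹ * G c') ≤
          pmfMean (movementStep lam σ c) fun c => if HasContact σ c then ρ else G c / γ := by
        refine pmfMean_mono _ fun c' => ?_
        rw [inv_mul_eq_div]
        split_ifs
        exacts [hFle c', le_rfl]
      refine le_trans ?_ h1
      have h2 := movementStep_drift lam h hc
      have h3 : γ ≤ pmfMean (movementStep lam σ c) G - G c := by
        rw [hG, h2, hγ]
        refine div_le_div_of_nonneg_right ?_ hn0.le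
        rw [mul_comm _ (m : ℝ), hm, ← nsmul_eq_mul, ← Finset.sum_const]
        refine Finset.sum_le_sum fun u hu => ?_
        refine hdrift (c u) (awarePart σ c) ?_
        rw [Finset.mem_map]
        rintro ⟨w, _, hw⟩
        have : (w : V) = u := c.injective hw
        exact w.2 (this ▸ (Finset.mem_filter.1 hu).2)
      rw [pmfMean_const_mul, inv_mul_eq_div, ← sub_nonneg, sub_add_eq_sub_sub, ← sub_div,
        sub_nonneg, le_div_iff₀ hγ0, one_mul]
      exact h3

/-- The law of the configuration at the next iteration. -/
def iterationKernel [Nonempty V] (lam : ℝ) (σ : V → BehaviorGroup) (c : LatticeConfig V L) :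
    PMF (LatticeConfig V L) :=
  movementCount.bind fun j => movementSteps lam σ j c

lemma movementCount_apply (j : ℕ) : movementCount j = (2⁻¹ : ℝ≥0∞) ^ (j + 1) := rfl

/-- Decomposition according to the last activation before the iteration. -/
lemma iterationKernel_apply [Nonempty V] (lam : ℝ) (σ : V → BehaviorGroup)
    (c x : LatticeConfig V L) :
    iterationKernel lam σ c x = 2⁻¹ * (PMF.pure c) x +
      2⁻¹ * ((iterationKernel lam σ c).bind (movementStep lam σ)) x := by
  rw [iterationKernel, PMF.bind_bind, PMF.bind_apply, PMF.bind_apply,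
    tsum_eq_zero_add' ENNReal.summable, ← ENNReal.tsum_mul_left]
  simp only [movementCount_apply, zero_add, movementSteps, pow_succ]
  congr 1
  · rw [pow_zero, one_mul]
  · refine tsum_congr fun j => ?_
    ring

lemma pmfMean_iterationKernel [Nonempty V] [NeZero L] (lam : ℝ) (σ : V → BehaviorGroup)
    (c : LatticeConfig V L) (F : LatticeConfig V L → ℝ) :
    pmfMean (iterationKernel lam σ c) F = 1 / 2 * F c + 1 / 2 *
      pmfMean (iterationKernel lam σ c) fun c' => pmfMean (movementStep lam σ c') F := by
  rw [← pmfMean_bind, ← pmfMean_pure c F]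
  simp only [pmfMean, Finset.mul_sum, ← Finset.sum_add_distrib]
  refine Finset.sum_congr rfl fun x _ => ?_
  rw [iterationKernel_apply, ENNReal.toReal_add, ENNReal.toReal_mul, ENNReal.toReal_mul,
    ENNReal.toReal_inv, ENNReal.toReal_ofNat]
  · ring
  · exact ENNReal.mul_ne_top (by simp) (PMF.apply_ne_top _ _)
  · exact ENNReal.mul_ne_top (by simp) (PMF.apply_ne_top _ _)

open Classical in
/-- The potential of `exists_movement_potential` at the time scale of iterations. -/
lemma iterationKernel_drift [Nonempty V] [NeZero L] {lam ρ : ℝ} {σ : V → BehaviorGroup}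
    {F : LatticeConfig V L → ℝ} (hF : ∀ c, F c + (if HasContact σ c then
      -(ρ * (2 / Fintype.card V)) else 1) ≤ pmfMean (movementStep lam σ c) F)
    (c : LatticeConfig V L) :
    F c + pmfMean (iterationKernel lam σ c) (fun c' => if HasContact σ c' then
      -(ρ * (2 / Fintype.card V)) else 1) ≤ pmfMean (iterationKernel lam σ c) F := by
  have h1 := pmfMean_iterationKernel lam σ c F
  have h2 := pmfMean_mono (iterationKernel lam σ c) hF
  rw [pmfMean_add] at h2
  -- The kernel satisfies E F = F/2 + E[step F]/2, while step F ≥ F + drift pointwise; solve for E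
  -- F. The drift is thereby evaluated at the configuration of the next iteration.
  linarith

end Drift

/-! ### Trajectories of a finite Markov chain. -/

section MarkovChain

variable {S : Type} [Fintype S] [MeasurableSpace S] [DiscreteMeasurableSpace S]

/-- `f ω` depends on the coordinates of `ω` up to time `i` only. -/
def DependsUpTo {γ : Type*} (i : ℕ) (f : (ℕ → S) → γ) : Prop :=
  ∀ ω ω' : ℕ → S, (∀ j ≤ i, ω j = ω' j) → f ω = f ω'

/-- The trajectory that follows `y` up to time `i` and is constant afterwards. -/
def extendPath (s₀ : S) (i : ℕ) (y : Finset.Iic i → S) : ℕ → S := fun j =>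
  if h : j ≤ i then y ⟨j, Finset.mem_Iic.2 h⟩ else s₀

omit [Fintype S] [MeasurableSpace S] [DiscreteMeasurableSpace S] in
lemma DependsUpTo.eq_extendPath {γ : Type*} {i : ℕ} {f : (ℕ → S) → γ} (hf : DependsUpTo i f)
    (s₀ : S) (ω : ℕ → S) : f ω = f (extendPath s₀ i (Preorder.frestrictLe i ω)) := by
  refine hf _ _ fun j hj => ?_
  simp [extendPath, hj]

/-- The function factors through a finite set of initial paths, where everything is measurable (and,
below, integrable). -/
lemma DependsUpTo.measurable {γ : Type*} [MeasurableSpace γ] [Nonempty S] {i : ℕ}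
    {f : (ℕ → S) → γ} (hf : DependsUpTo i f) : Measurable f := by
  have s₀ : S := Classical.arbitrary S
  have e : f = (fun y => f (extendPath s₀ i y)) ∘ Preorder.frestrictLe (π := fun _ => S) i :=
    funext fun ω => hf.eq_extendPath s₀ ω
  rw [e]
  exact (measurable_of_finite _).comp (Preorder.measurable_frestrictLe i)

lemma DependsUpTo.integrable [Nonempty S] {i : ℕ} {f : (ℕ → S) → ℝ} (hf : DependsUpTo i f)
    (P : Measure (ℕ → S)) [IsFiniteMeasure P] : Integrable f P := by
  have s₀ : S := Classical.arbitrary S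
  have e : f = (fun y => f (extendPath s₀ i y)) ∘ Preorder.frestrictLe (π := fun _ => S) i :=
    funext fun ω => hf.eq_extendPath s₀ ω
  rw [e]
  exact Integrable.comp_measurable Integrable.of_finite (Preorder.measurable_frestrictLe i)

/-- Existence of the Markov chain with transition probabilities `κ` started in `x₀`. -/
theorem exists_markovChain (κ : S → PMF S) (x₀ : S) :
    ∃ P : Measure (ℕ → S), IsProbabilityMeasure P ∧ P {ω | ω 0 = x₀} = 1 ∧
      (∀ (i : ℕ) (z : ℕ → S), P {ω | ∀ j ≤ i + 1, ω j = z j} =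
        P {ω | ∀ j ≤ i, ω j = z j} * κ (z i) (z (i + 1))) ∧
      ∀ (i : ℕ) (g : (ℕ → S) → S → ℝ), DependsUpTo i g →
        ∫ ω, g ω (ω (i + 1)) ∂P = ∫ ω, pmfMean (κ (ω i)) (g ω) ∂P := by
  let K : (n : ℕ) → ProbabilityTheory.Kernel (Finset.Iic n → S) S := fun n =>
    ⟨fun y => (κ (y ⟨n, Finset.mem_Iic.2 le_rfl⟩)).toMeasure,
      (measurable_of_finite (fun s => (κ s).toMeasure)).comp (measurable_pi_apply _)⟩
  have hK : ∀ n y, K n y = (κ (y ⟨n, Finset.mem_Iic.2 le_rfl⟩)).toMeasure := fun _ _ => rfl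
  have hM : ∀ n, ProbabilityTheory.IsMarkovKernel (K n) := fun n =>
    ⟨fun y => by rw [hK]; infer_instance⟩
  let P : Measure (ℕ → S) := ProbabilityTheory.Kernel.traj (X := fun _ => S) K 0 (fun _ => x₀)
  have hP : IsProbabilityMeasure P := by
    change IsProbabilityMeasure
      (ProbabilityTheory.Kernel.traj (X := fun _ => S) K 0 (fun _ => x₀))
    infer_instance
  have hstep : ∀ i : ℕ, Measure.compProd (P.map (Preorder.frestrictLe (π := fun _ => S) i)) (K i) =
      P.map fun ω => (Preorder.frestrictLe (π := fun _ => S) i ω, ω (i + 1)) := by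
    intro i
    have h1 := ProbabilityTheory.Kernel.partialTraj_compProd_eq_map_traj (X := fun _ => S)
      (κ := K) (Nat.zero_le i) (x₀ := fun _ => x₀)
    rwa [← ProbabilityTheory.Kernel.traj_map_frestrictLe_apply] at h1
  have hmeas : ∀ i : ℕ, Measurable fun ω : ℕ → S =>
      (Preorder.frestrictLe (π := fun _ => S) i ω, ω (i + 1)) := fun i =>
    (Preorder.measurable_frestrictLe i).prodMk (measurable_pi_apply _)
  refine ⟨P, hP, ?_, ?_, ?_⟩
  · have h0 := ProbabilityTheory.Kernel.traj_map_frestrictLe_apply (X := fun _ => S)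
      (κ := K) 0 0 (fun _ => x₀)
    rw [ProbabilityTheory.Kernel.partialTraj_self, ProbabilityTheory.Kernel.id_apply] at h0
    have hset : MeasurableSet {y : Finset.Iic 0 → S | y ⟨0, Finset.mem_Iic.2 le_rfl⟩ = x₀} :=
      Set.Finite.measurableSet (Set.toFinite _)
    have h1 : P {ω | ω 0 = x₀} = (P.map (Preorder.frestrictLe (π := fun _ => S) 0))
        {y | y ⟨0, Finset.mem_Iic.2 le_rfl⟩ = x₀} := by
      rw [Measure.map_apply (Preorder.measurable_frestrictLe 0) hset]; rfl
    rw [h1, h0, Measure.dirac_apply' _ hset]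
    simp
  · intro i z
    have hs : MeasurableSet {y : Finset.Iic i → S | ∀ j, y j = z j} :=
      Set.Finite.measurableSet (Set.toFinite _)
    have ht : MeasurableSet ({z (i + 1)} : Set S) := MeasurableSet.of_discrete
    have h1 := congrArg (fun μ : Measure ((Finset.Iic i → S) × S) =>
      μ ({y : Finset.Iic i → S | ∀ j, y j = z j} ×ˢ {z (i + 1)})) (hstep i)
    rw [Measure.compProd_apply_prod hs ht, Measure.map_apply (hmeas i) (hs.prod ht)] at h1
    have e1 : (fun ω : ℕ → S => (Preorder.frestrictLe (π := fun _ => S) i ω, ω (i + 1))) ⁻¹'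
        ({y : Finset.Iic i → S | ∀ j, y j = z j} ×ˢ {z (i + 1)}) = {ω | ∀ j ≤ i + 1, ω j = z j} := by
      ext ω
      simp only [Set.mem_preimage, Set.mem_prod, Set.mem_ofPred_eq, Set.mem_singleton_iff,
        Subtype.forall, Finset.mem_Iic]
      constructor
      · rintro ⟨h, h'⟩ j hj
        rcases Nat.lt_or_ge j (i + 1) with hlt | hge
        · exact h j (by omega)
        · obtain rfl : j = i + 1 := by omega
          exact h'
      · intro h
        exact ⟨fun j hj => h j (by omega), h _ le_rfl⟩
    have e2 : ∫⁻ y in {y : Finset.Iic i → S | ∀ j, y j = z j}, K i y {z (i + 1)}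
        ∂(P.map (Preorder.frestrictLe (π := fun _ => S) i)) =
        ∫⁻ y in {y : Finset.Iic i → S | ∀ j, y j = z j}, κ (z i) (z (i + 1))
        ∂(P.map (Preorder.frestrictLe (π := fun _ => S) i)) := by
      refine setLIntegral_congr_fun hs fun y hy => ?_
      rw [hK, PMF.toMeasure_apply_singleton _ _ ht]
      rw [hy ⟨i, Finset.mem_Iic.2 le_rfl⟩]
    rw [e1, e2, setLIntegral_const, Measure.map_apply (Preorder.measurable_frestrictLe i) hs] at h1
    rw [← h1, mul_comm]
    congr 2
    ext ω
    simp
  · intro i g hg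
    have hint : Integrable (fun p : (Finset.Iic i → S) × S => g (extendPath x₀ i p.1) p.2)
      (Measure.compProd (P.map (Preorder.frestrictLe (π := fun _ => S) i)) (K i)) := Integrable.of_finite
    have h1 := Measure.integral_compProd hint
    rw [hstep, integral_map (hmeas i).aemeasurable (measurable_of_finite _).aestronglyMeasurable,
      integral_map (Preorder.measurable_frestrictLe i).aemeasurable
        (measurable_of_finite _).aestronglyMeasurable] at h1
    simp only [← hg.eq_extendPath x₀] at h1
    rw [h1]
    refine integral_congr_ae (Filter.Eventually.of_forall fun ω => ?_)
    beta_reduce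
    rw [hK, PMF.integral_eq_sum]
    rfl

end MarkovChain

/-! ### Visits and batches along a trajectory. -/

open Classical in
/-- The number of visits to `B` at the times `1, …, i`. -/
def visitCount {S : Type} (B : S → Prop) (i : ℕ) (ω : ℕ → S) : ℕ :=
  ∑ j ∈ Finset.range i, if B (ω (j + 1)) then 1 else 0

/-- The number of times at which the number of visits lies in `[k K, (k + 1) K)`. -/
def batchLength {S : Type} (B : S → Prop) (K k : ℕ) (ω : ℕ → S) : ℕ :=
  {i | visitCount B i ω / K = k}.ncard

section Visits

variable {S : Type} {B : S → Prop}

open Classical in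
lemma visitCount_succ (i : ℕ) (ω : ℕ → S) :
    visitCount B (i + 1) ω = visitCount B i ω + if B (ω (i + 1)) then 1 else 0 :=
  Finset.sum_range_succ _ _

lemma visitCount_mono (ω : ℕ → S) : Monotone fun i => visitCount B i ω :=
  monotone_nat_of_le_succ fun i => by rw [visitCount_succ]; exact Nat.le_add_right _ _

lemma visitCount_congr {i : ℕ} {ω ω' : ℕ → S} (h : ∀ j ≤ i, ω j = ω' j) {i' : ℕ} (hi' : i' ≤ i) :
    visitCount B i' ω = visitCount B i' ω' := by
  refine Finset.sum_congr rfl fun j hj => ?_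
  rw [h (j + 1) (by have := Finset.mem_range.1 hj; omega)]

/-- Once `k * K` visits have been made, every earlier batch is over, so its length is read off the
path so far. -/
lemma batchLength_congr {K k j i : ℕ} (hK : 0 < K) (hj : j < k) {ω ω' : ℕ → S}
    (h : ∀ j ≤ i, ω j = ω' j) (hi : k * K ≤ visitCount B i ω) :
    batchLength B K j ω = batchLength B K j ω' := by
  have key : ∀ ω₁ ω₂ : ℕ → S, (∀ j ≤ i, ω₁ j = ω₂ j) → k * K ≤ visitCount B i ω₁ →
      ∀ l, visitCount B l ω₁ / K = j → visitCount B l ω₂ / K = j := by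
    intro ω₁ ω₂ h hi l hl
    have hli : l ≤ i := by
      by_contra hlt
      have h1 := visitCount_mono (B := B) ω₁ (not_le.1 hlt).le
      have h2 : k ≤ visitCount B l ω₁ / K := (Nat.le_div_iff_mul_le hK).2 (hi.trans h1)
      omega
    rw [← visitCount_congr h hli, hl]
  unfold batchLength
  congr 1
  ext l
  exact ⟨key ω ω' h hi l, key ω' ω (fun j hj => (h j hj).symm)
    (by rwa [← visitCount_congr h le_rfl]) l⟩

/-- The first `k` batches end when `k K` visits have been made. -/
lemma sum_batchLength {K k T : ℕ} (hK : 0 < K) {ω : ℕ → S} (hT : k * K ≤ visitCount B T ω)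
    (hlt : ∀ i < T, visitCount B i ω < k * K) :
    ∑ j ∈ Finset.range k, batchLength B K j ω = T := by
  have h1 : ∀ j ∈ Finset.range k, batchLength B K j ω =
      ((Finset.range T).filter fun i => visitCount B i ω / K = j).card := by
    intro j hj
    rw [Finset.mem_range] at hj
    rw [batchLength, ← Set.ncard_coe_finset]
    congr 1
    ext i
    simp only [Set.mem_ofPred_eq, Finset.coe_filter, Finset.mem_range]
    refine ⟨fun h => ⟨?_, h⟩, fun h => h.2⟩
    by_contra hge
    have h2 := visitCount_mono (B := B) ω (not_lt.1 hge)
    have h3 : k ≤ visitCount B i ω / K := (Nat.le_div_iff_mul_le hK).2 (hT.trans h2)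
    omega
  rw [Finset.sum_congr rfl h1, ← Finset.card_eq_sum_card_fiberwise, Finset.card_range]
  intro i hi
  have hi' : i < T := by simpa using hi
  have := (Nat.div_lt_iff_lt_mul hK).2 (hlt i hi')
  simpa using this

lemma sum_batchLength_le {K k i : ℕ} (hK : 0 < K) {ω : ℕ → S} (hi : k * K ≤ visitCount B i ω) :
    ∑ j ∈ Finset.range k, batchLength B K j ω ≤ i := by
  classical
  have hex : ∃ i, k * K ≤ visitCount B i ω := ⟨i, hi⟩
  rw [sum_batchLength hK (Nat.find_spec hex) fun i h => not_le.1 (Nat.find_min hex h)]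
  exact Nat.find_min' hex hi

/-- The counter grows by at most one per step, so it hits `k * K` without overshooting. -/
lemma visitCount_sum_batchLength {K k i : ℕ} (hK : 0 < K) {ω : ℕ → S}
    (hi : k * K ≤ visitCount B i ω) :
    visitCount B (∑ j ∈ Finset.range k, batchLength B K j ω) ω = k * K := by
  classical
  have hex : ∃ i, k * K ≤ visitCount B i ω := ⟨i, hi⟩
  rw [sum_batchLength hK (Nat.find_spec hex) fun i h => not_le.1 (Nat.find_min hex h)]
  refine le_antisymm ?_ (Nat.find_spec hex)
  rcases h0 : Nat.find hex with _ | m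
  · simp [visitCount]
  · have hm : visitCount B m ω < k * K := not_le.1 (Nat.find_min hex (by omega))
    rw [visitCount_succ]
    split_ifs <;> omega

/-- Otherwise finitely many finite batches would cover all times. -/
lemma exists_visitCount_ge {K : ℕ} (hK : 0 < K) {ω : ℕ → S}
    (hfin : ∀ k, {i | visitCount B i ω / K = k}.Finite) (k : ℕ) :
    ∃ i, k * K ≤ visitCount B i ω := by
  by_contra! h
  have h1 : (⋃ j ∈ Finset.range k, {i | visitCount B i ω / K = j}).Finite :=
    (Finset.range k).finite_toSet.biUnion fun j _ => hfin j
  refine Set.infinite_univ (h1.subset fun i _ => ?_)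
  simp only [Set.mem_iUnion, Finset.mem_range]
  exact ⟨_, (Nat.div_lt_iff_lt_mul hK).2 (h i), rfl⟩

lemma tsum_batch_indicator (K k : ℕ) (ω : ℕ → S) :
    ∑' i, (if visitCount B i ω / K = k then (1 : ℝ≥0∞) else 0) =
      ({i | visitCount B i ω / K = k}.encard : ℝ≥0∞) := by
  rw [← ENNReal.tsum_set_one, tsum_subtype {i | visitCount B i ω / K = k} fun _ => (1 : ℝ≥0∞)]
  refine tsum_congr fun i => ?_
  simp [Set.indicator_apply]

lemma batchLength_eq_toReal (K k : ℕ) (ω : ℕ → S) :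
    (batchLength B K k ω : ℝ) =
      (∑' i, (if visitCount B i ω / K = k then (1 : ℝ≥0∞) else 0)).toReal := by
  rw [tsum_batch_indicator, batchLength]
  rcases Set.finite_or_infinite {i | visitCount B i ω / K = k} with h | h
  · rw [← h.cast_ncard_eq]; simp
  · rw [h.ncard, h.encard_eq]; simp

/-- Only an inequality: on an infinite batch `ncard` is 0 while the series is infinite. -/
lemma batchLength_le_tsum (K k : ℕ) (ω : ℕ → S) :
    (batchLength B K k ω : ℝ≥0∞) ≤
      ∑' i, (if visitCount B i ω / K = k then (1 : ℝ≥0∞) else 0) := by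
  rw [tsum_batch_indicator, batchLength]
  rcases Set.finite_or_infinite {i | visitCount B i ω / K = k} with h | h
  · rw [← h.cast_ncard_eq]; simp
  · rw [h.ncard]; simp

end Visits

/-! ### The expected length of a batch. -/

section Batches

variable {S : Type} [Fintype S] [MeasurableSpace S] [DiscreteMeasurableSpace S] {B : S → Prop}

omit [Fintype S] [MeasurableSpace S] [DiscreteMeasurableSpace S] in
lemma dependsUpTo_visitCount (i : ℕ) : DependsUpTo i (visitCount B i) :=
  fun _ _ h => visitCount_congr h le_rfl

lemma measurable_visitCount [Nonempty S] (i : ℕ) : Measurable (visitCount B i) :=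
  (dependsUpTo_visitCount i).measurable

lemma measurable_batch_indicator [Nonempty S] (K k : ℕ) : Measurable fun ω =>
    ∑' i, (if visitCount B i ω / K = k then (1 : ℝ≥0∞) else 0) := by
  refine Measurable.tsum fun i => ?_
  exact (measurable_of_countable fun m : ℕ => if m / K = k then (1 : ℝ≥0∞) else 0).comp
    (measurable_visitCount i)

lemma measurable_batchLength [Nonempty S] (K k : ℕ) : Measurable (batchLength B K k) := by
  have e : batchLength B K k = fun ω =>
      ⌊(∑' i, (if visitCount B i ω / K = k then (1 : ℝ≥0∞) else 0)).toReal⌋₊ := by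
    funext ω
    rw [← batchLength_eq_toReal, Nat.floor_natCast]
  rw [e]
  exact Nat.measurable_floor.comp (measurable_batch_indicator K k).ennreal_toReal

open Classical in
/-- Bound for the total length of a batch on an event that is known when the batch starts. -/
lemma sum_measure_batch_le [Nonempty S] {κ : S → PMF S} {P : Measure (ℕ → S)}
    [IsProbabilityMeasure P]
    (hstep : ∀ (i : ℕ) (g : (ℕ → S) → S → ℝ), DependsUpTo i g →
        ∫ ω, g ω (ω (i + 1)) ∂P = ∫ ω, pmfMean (κ (ω i)) (g ω) ∂P)
    {ρ δ : ℝ} (hδ : 0 ≤ δ) {F : S → ℝ} (hF0 : ∀ c, 0 ≤ F c) (hFρ : ∀ c, F c ≤ ρ)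
    (hF : ∀ c, F c + pmfMean (κ c) (fun c' => if B c' then -δ else 1) ≤ pmfMean (κ c) F)
    {K : ℕ} (hK : 0 < K) (k : ℕ) {A : Set (ℕ → S)} (hA : MeasurableSet A)
    (hdet : ∀ i, DependsUpTo i fun ω => ω ∈ A ∧ k * K ≤ visitCount B i ω) (n : ℕ) :
    ∑ i ∈ Finset.range n, P.real {ω | ω ∈ A ∧ visitCount B i ω / K = k} ≤
      (K + ρ + K * δ) * P.real A := by
  set M : ℝ := K + ρ + K * δ with hM
  -- Bounds the expected remaining length when `r` visits are missing: `r` visiting iterations, plus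
  -- non-visiting ones, each raising F by 1 in mean, paid for by the room ρ - F(c) and by the losses
  -- δ at visits.
  let v : S → ℕ → ℝ := fun c r => if r = 0 then 0 else r + ρ + r * δ - F c
  have hv0 : ∀ c r, 0 ≤ v c r := by
    intro c r
    simp only [v]
    split_ifs
    · exact le_rfl
    · have := hFρ c
      have : (0 : ℝ) ≤ r * δ := by positivity
      have : (0 : ℝ) ≤ r := by positivity
      linarith
  have hvM : ∀ c r, r ≤ K → v c r ≤ M := by
    intro c r hr
    have hr' : (r : ℝ) ≤ K := by exact_mod_cast hr
    have hρ0 : 0 ≤ ρ := (hF0 c).trans (hFρ c)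
    simp only [v]
    split_ifs
    · positivity
    · have := hF0 c
      have : (r : ℝ) * δ ≤ K * δ := by gcongr
      linarith
  have hvstep : ∀ c r, r ≠ 0 → pmfMean (κ c) (fun c' => v c' (r - if B c' then 1 else 0)) ≤
      v c r - 1 := by
    intro c r hr
    have h1 : ∀ c', v c' (r - if B c' then 1 else 0) ≤
        (r + ρ + r * δ - 1) - F c' + (if B c' then -δ else 1) := by
      intro c'
      have hr1 : 1 ≤ r := Nat.one_le_iff_ne_zero.2 hr
      have hr1' : (1 : ℝ) ≤ r := by exact_mod_cast hr1
      have := hFρ c'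
      by_cases hB : B c'
      · simp only [v, if_pos hB]
        split_ifs with h3
        -- At the last visit the bound drops to 0 instead of ρ - F(c'), which is allowed because F ≤
        -- ρ.
        · obtain rfl : r = 1 := by omega
          push_cast
          linarith
        · rw [Nat.cast_sub hr1]; push_cast; linarith
      · simp only [v, if_neg hB, Nat.sub_zero, if_neg hr]
        linarith
    have h2 := pmfMean_mono (κ c) h1
    rw [pmfMean_add, pmfMean_sub, pmfMean_const] at h2
    have h3 := hF c
    have h4 : v c r = r + ρ + r * δ - F c := by simp only [v, if_neg hr]
    linarith
  let N := visitCount B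
  -- Indicator that `A` occurs and batch `k` has started, possibly also ended. Truncated subtraction
  -- in `w` makes `v` vanish after the batch.
  let E : ℕ → (ℕ → S) → ℝ := fun i ω => if ω ∈ A ∧ k * K ≤ N i ω then 1 else 0
  let w : ℕ → (ℕ → S) → ℝ := fun i ω => E i ω * v (ω i) ((k + 1) * K - N i ω)
  let I : ℕ → (ℕ → S) → ℝ := fun i ω => if ω ∈ A ∧ N i ω / K = k then 1 else 0
  have dE : ∀ i, DependsUpTo i (E i) := fun i ω ω' h => by
    have := hdet i ω ω' h
    simp only at this
    simp only [E, N, this]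
  have dN : ∀ i, DependsUpTo i (N i) := dependsUpTo_visitCount
  have hIE : ∀ i ω, I i ω = E i ω * if (k + 1) * K - N i ω = 0 then 0 else 1 := by
    intro i ω
    have h1 : N i ω / K = k ↔ k * K ≤ N i ω ∧ (k + 1) * K - N i ω ≠ 0 := by
      rw [Nat.div_eq_iff hK, Nat.succ_mul]
      omega
    simp only [I, E, h1]
    split_ifs <;> simp_all
  have dI : ∀ i, DependsUpTo i (I i) := fun i ω ω' h => by
    rw [hIE, hIE, dE i ω ω' h, dN i ω ω' h]
  have dw : ∀ i, DependsUpTo i (w i) := fun i ω ω' h => by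
    simp only [w]
    rw [dE i ω ω' h, dN i ω ω' h, h i le_rfl]
  -- During the batch `w` loses at least 1 per iteration in mean; the start of the batch, where E
  -- jumps, adds at most M. Summation telescopes.
  have hmain : ∀ i, ∫ ω, w (i + 1) ω ∂P + ∫ ω, I i ω ∂P ≤
      ∫ ω, w i ω ∂P + M * (∫ ω, E (i + 1) ω ∂P - ∫ ω, E i ω ∂P) := by
    intro i
    let g : (ℕ → S) → S → ℝ := fun ω s =>
      E i ω * v s ((k + 1) * K - N i ω - if B s then 1 else 0)
    have dg : DependsUpTo i g := fun ω ω' h => by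
      funext s
      simp only [g]
      rw [dE i ω ω' h, dN i ω ω' h]
    have h1 : ∀ ω, w (i + 1) ω ≤ g ω (ω (i + 1)) + M * (E (i + 1) ω - E i ω) := by
      intro ω
      have e1 : N (i + 1) ω = N i ω + if B (ω (i + 1)) then 1 else 0 := visitCount_succ i ω
      have e2 : (k + 1) * K - N (i + 1) ω =
          (k + 1) * K - N i ω - if B (ω (i + 1)) then 1 else 0 := by rw [e1, Nat.sub_add_eq]
      have hmono : N i ω ≤ N (i + 1) ω := by rw [e1]; exact Nat.le_add_right _ _
      simp only [w, g, e2]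
      by_cases hi : ω ∈ A ∧ k * K ≤ N i ω
      · have hi' : ω ∈ A ∧ k * K ≤ N (i + 1) ω := ⟨hi.1, hi.2.trans hmono⟩
        simp only [E, if_pos hi, if_pos hi']
        linarith
      · simp only [E, if_neg hi]
        by_cases hi' : ω ∈ A ∧ k * K ≤ N (i + 1) ω
        · rw [if_pos hi', ← e2]
          have := hvM (ω (i + 1)) ((k + 1) * K - N (i + 1) ω) (by
            rw [Nat.succ_mul]; have := hi'.2; omega)
          linarith
        · rw [if_neg hi']; linarith
    have h2 : ∀ ω, pmfMean (κ (ω i)) (g ω) ≤ w i ω - I i ω := by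
      intro ω
      rw [hIE]
      simp only [g, w]
      rw [pmfMean_const_mul, ← mul_sub]
      refine mul_le_mul_of_nonneg_left ?_ (by simp only [E]; split_ifs <;> norm_num)
      by_cases hr : (k + 1) * K - N i ω = 0
      · simp only [hr, Nat.zero_sub, if_true, v, pmfMean_const]; norm_num
      · rw [if_neg hr]; exact hvstep _ _ hr
    have dg' : DependsUpTo (i + 1) fun ω => g ω (ω (i + 1)) := fun ω ω' h => by
      beta_reduce
      rw [dg ω ω' fun j hj => h j (by omega), h (i + 1) le_rfl]
    have dp : DependsUpTo i fun ω => pmfMean (κ (ω i)) (g ω) := fun ω ω' h => by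
      beta_reduce
      rw [dg ω ω' h, h i le_rfl]
    have i1 := (dw (i + 1)).integrable P
    have i2 := dg'.integrable P
    have i3 := (dE (i + 1)).integrable P
    have i4 := (dE i).integrable P
    have i5 := dp.integrable P
    have i6 := (dw i).integrable P
    have i7 := (dI i).integrable P
    have i8 : Integrable (fun ω => M * (E (i + 1) ω - E i ω)) P := (i3.sub i4).const_mul M
    have h3 := integral_mono i1 (i2.add i8) h1
    have h4 := integral_mono i5 (i6.sub i7) h2
    simp only [Pi.add_apply, Pi.sub_apply] at h3 h4
    rw [integral_add i2 i8, integral_const_mul, integral_sub i3 i4,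
      hstep i g dg] at h3
    rw [integral_sub i6 i7] at h4
    linarith
  have hsum : ∀ n, ∑ i ∈ Finset.range n, ∫ ω, I i ω ∂P + ∫ ω, w n ω ∂P ≤
      M * ∫ ω, E n ω ∂P := by
    intro n
    induction n with
    | zero =>
      rw [Finset.range_zero, Finset.sum_empty, zero_add, ← integral_const_mul]
      refine integral_mono ((dw 0).integrable P) (((dE 0).integrable P).const_mul M) fun ω => ?_
      simp only [w]
      by_cases h : ω ∈ A ∧ k * K ≤ N 0 ω
      · have := hvM (ω 0) ((k + 1) * K - N 0 ω) (by rw [Nat.succ_mul]; have := h.2; omega)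
        simp only [E, if_pos h]; linarith
      · simp only [E, if_neg h]; simp
    | succ n ih =>
      rw [Finset.sum_range_succ]
      have := hmain n
      linarith
  have hI : ∀ i, P.real {ω | ω ∈ A ∧ visitCount B i ω / K = k} = ∫ ω, I i ω ∂P := by
    intro i
    have hm : MeasurableSet {ω | ω ∈ A ∧ visitCount B i ω / K = k} :=
      hA.inter ((measurable_visitCount i) (MeasurableSet.of_discrete (s := {m | m / K = k})))
    rw [← integral_indicator_one hm]
    refine integral_congr_ae (Filter.Eventually.of_forall fun ω => ?_)
    simp [I, N, Set.indicator_apply]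
  have hEA : ∫ ω, E n ω ∂P ≤ P.real A := by
    rw [← integral_indicator_one hA]
    refine integral_mono ((dE n).integrable P) ((integrable_const 1).indicator hA) fun ω => ?_
    simp only [E, Set.indicator_apply, Pi.one_apply]
    split_ifs <;> simp_all
  have hw0 : 0 ≤ ∫ ω, w n ω ∂P := integral_nonneg fun ω =>
    mul_nonneg (by simp only [E]; split_ifs <;> norm_num) (hv0 _ _)
  have hM0 : 0 ≤ M := by
    have s : S := Classical.arbitrary S
    have := (hF0 s).trans (hFρ s)
    positivity
  simp only [hI]
  have h1 := hsum n
  have h2 := mul_le_mul_of_nonneg_left hEA hM0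
  linarith

end Batches

/-! ### From integrals over conditioning events to conditional expectations. -/

section CondExpBound

variable {Ω : Type} {m m₀ : MeasurableSpace Ω} {P : Measure Ω} [IsProbabilityMeasure P]

/-- A conditional expectation is bounded by `c` if the integrals over the events of the
conditioning σ-algebra are. -/
lemma integrable_and_condExp_le (hm : m ≤ m₀) {D : Ω → ℕ} (hD : Measurable D) {c : ℝ} (hc : 0 ≤ c)
    (h : ∀ A, MeasurableSet[m] A → ∫⁻ ω in A, (D ω : ℝ≥0∞) ∂P ≤ ENNReal.ofReal c * P A) :
    Integrable (fun ω => (D ω : ℝ)) P ∧ ∀ᵐ ω ∂P, (P[fun ω => (D ω : ℝ) | m]) ω ≤ c := by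
  have hmeas : Measurable fun ω => (D ω : ℝ) := measurable_from_nat.comp hD
  have hint : Integrable (fun ω => (D ω : ℝ)) P := by
    refine ⟨hmeas.aestronglyMeasurable, ?_⟩
    have h1 := h Set.univ MeasurableSet.univ
    rw [Measure.restrict_univ, measure_univ, mul_one] at h1
    refine lt_of_le_of_lt (le_of_eq ?_) (h1.trans_lt ENNReal.ofReal_lt_top)
    refine lintegral_congr fun ω => ?_
    rw [Real.enorm_natCast]
  refine ⟨hint, ?_⟩
  have htrim : (P[fun ω => (D ω : ℝ) | m]) ≤ᵐ[P.trim hm] fun _ => c := by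
    have : IsFiniteMeasure (P.trim hm) := isFiniteMeasure_trim hm
    refine ae_le_of_forall_setIntegral_le
      (integrable_condExp.trim hm stronglyMeasurable_condExp) (integrable_const c) fun s hs _ => ?_
    rw [← setIntegral_trim hm stronglyMeasurable_condExp hs, setIntegral_condExp hm hint hs,
      setIntegral_const, smul_eq_mul, Measure.real, trim_measurableSet_eq hm hs,
      integral_eq_lintegral_of_nonneg_ae (Filter.Eventually.of_forall fun ω => by positivity)
        hmeas.aestronglyMeasurable]
    simp only [ENNReal.ofReal_natCast]
    have h1 := ENNReal.toReal_mono (ENNReal.mul_ne_top ENNReal.ofReal_ne_top (measure_ne_top P s))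
      (h s hs)
    rwa [ENNReal.toReal_mul, ENNReal.toReal_ofReal hc, mul_comm] at h1
  exact ae_of_ae_trim hm htrim

end CondExpBound

/-! ### Totals over batches and the bounds given the batch history. -/

/-- The sum of `φ` over the states visited during the `k`-th batch. -/
def batchTotal {S : Type} (B : S → Prop) (φ : S → ℕ) (K k : ℕ) (ω : ℕ → S) : ℕ :=
  ∑ i ∈ Finset.Ico (∑ j ∈ Finset.range k, batchLength B K j ω)
    (∑ j ∈ Finset.range (k + 1), batchLength B K j ω), φ (ω (i + 1))

section Batches

variable {S : Type} [Fintype S] [MeasurableSpace S] [DiscreteMeasurableSpace S] [Nonempty S]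
  {B : S → Prop}

lemma measurable_batchTotal (φ : S → ℕ) (K k : ℕ) : Measurable (batchTotal B φ K k) := by
  let Φ : (ℕ × ℕ) × (ℕ → S) → ℕ := fun p => ∑ i ∈ Finset.Ico p.1.1 p.1.2, φ (p.2 (i + 1))
  have hΦ : Measurable Φ := by
    refine measurable_from_prod_countable_right fun p => ?_
    change Measurable fun ω : ℕ → S => ∑ i ∈ Finset.Ico p.1 p.2, φ (ω (i + 1))
    exact Finset.measurable_sum _ fun i _ =>
      (measurable_of_finite φ).comp (measurable_pi_apply (i + 1))
  have hs : ∀ k, Measurable fun ω : ℕ → S => ∑ j ∈ Finset.range k, batchLength B K j ω := fun k =>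
    Finset.measurable_sum _ fun j _ => measurable_batchLength K j
  exact hΦ.comp (((hs k).prodMk (hs (k + 1))).prodMk measurable_id)

omit [Fintype S] [MeasurableSpace S] [DiscreteMeasurableSpace S] [Nonempty S] in
lemma batchTotal_congr (φ : S → ℕ) {K k j i : ℕ} (hK : 0 < K) (hj : j < k) {ω ω' : ℕ → S}
    (h : ∀ j ≤ i, ω j = ω' j) (hi : k * K ≤ visitCount B i ω) :
    batchTotal B φ K j ω = batchTotal B φ K j ω' := by
  have e : ∀ l ≤ k, ∑ j ∈ Finset.range l, batchLength B K j ω =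
      ∑ j ∈ Finset.range l, batchLength B K j ω' := fun l hl =>
    Finset.sum_congr rfl fun j hj =>
      batchLength_congr hK (lt_of_lt_of_le (Finset.mem_range.1 hj) hl) h hi
  unfold batchTotal
  rw [← e j hj.le, ← e (j + 1) hj]
  refine Finset.sum_congr rfl fun l hl => ?_
  have h1 := sum_batchLength_le (k := j + 1) hK (hi.trans' (Nat.mul_le_mul_right K hj))
  rw [h (l + 1) (by have := (Finset.mem_Ico.1 hl).2; omega)]

-- When all batches are finite, each contains exactly `K` visits, and each visit contributes at
-- least 1.
omit [Fintype S] [MeasurableSpace S] [DiscreteMeasurableSpace S] [Nonempty S] in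
lemma le_batchTotal {φ : S → ℕ} (hφ : ∀ s, B s → 1 ≤ φ s) {K : ℕ} (hK : 0 < K) {ω : ℕ → S}
    (hfin : ∀ k, {i | visitCount B i ω / K = k}.Finite) (k : ℕ) : K ≤ batchTotal B φ K k ω := by
  classical
  obtain ⟨i, hi⟩ := exists_visitCount_ge hK hfin (k + 1)
  have h1 := visitCount_sum_batchLength hK hi
  have h0 := visitCount_sum_batchLength (k := k) hK (hi.trans' (Nat.mul_le_mul_right K k.le_succ))
  have hle : ∑ j ∈ Finset.range k, batchLength B K j ω ≤
      ∑ j ∈ Finset.range (k + 1), batchLength B K j ω := by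
    rw [Finset.sum_range_succ]; exact Nat.le_add_right _ _
  have h2 := Finset.sum_range_add_sum_Ico (fun i => if B (ω (i + 1)) then 1 else 0) hle
  change visitCount B _ ω + _ = visitCount B _ ω at h2
  rw [h0, h1, Nat.succ_mul] at h2
  calc K = ∑ i ∈ Finset.Ico (∑ j ∈ Finset.range k, batchLength B K j ω)
        (∑ j ∈ Finset.range (k + 1), batchLength B K j ω), if B (ω (i + 1)) then 1 else 0 := by omega
    _ ≤ _ := Finset.sum_le_sum fun i _ => by
      split_ifs with hB
      exacts [hφ _ hB, Nat.zero_le _]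

open Classical in
/-- The batches of a Markov chain whose visits to `B` are controlled by a potential `F`. -/
theorem batch_bounds {κ : S → PMF S} {P : Measure (ℕ → S)} [IsProbabilityMeasure P]
    (hstep : ∀ (i : ℕ) (g : (ℕ → S) → S → ℝ), DependsUpTo i g →
        ∫ ω, g ω (ω (i + 1)) ∂P = ∫ ω, pmfMean (κ (ω i)) (g ω) ∂P)
    {ρ δ : ℝ} (hρ : 0 ≤ ρ) (hδ : 0 ≤ δ) {F : S → ℝ} (hF0 : ∀ c, 0 ≤ F c) (hFρ : ∀ c, F c ≤ ρ)
    (hF : ∀ c, F c + pmfMean (κ c) (fun c' => if B c' then -δ else 1) ≤ pmfMean (κ c) F)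
    {φ : S → ℕ} (hφ : ∀ s, B s → 1 ≤ φ s) {K : ℕ} (hK : 0 < K) (k : ℕ) :
    Integrable (fun ω => (batchLength B K k ω : ℝ)) P ∧
    (∀ᵐ ω ∂P, (P[fun ω => (batchLength B K k ω : ℝ) |
      batchHistory (batchLength B K) (batchTotal B φ K) k]) ω ≤ K + ρ + K * δ) ∧
    ∀ᵐ ω ∂P, K ≤ batchTotal B φ K k ω := by
  set M : ℝ := K + ρ + K * δ with hM
  have hM0 : 0 ≤ M := by positivity
  have hm : ∀ k, batchHistory (batchLength B K) (batchTotal B φ K) k ≤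
      MeasurableSpace.pi := fun k => by
    have h : Measurable fun (ω : ℕ → S) (i : Fin k) =>
        (batchLength B K i ω, batchTotal B φ K i ω) :=
      measurable_pi_lambda _ fun i =>
        (measurable_batchLength K i).prodMk (measurable_batchTotal φ K i)
    exact h.comap_le
  have hlint : ∀ k A, MeasurableSet[batchHistory (batchLength B K) (batchTotal B φ K) k] A →
      ∫⁻ ω in A, ∑' i, (if visitCount B i ω / K = k then (1 : ℝ≥0∞) else 0) ∂P ≤
        ENNReal.ofReal M * P A := by
    intro k A hAm
    have hA : MeasurableSet A := hm k A hAm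
    -- If `k * K` visits have occurred by time `i`, the earlier lengths and totals depend on the
    -- path up to `i` only, so the event is decided by then, as for the past of a stopping time.
    have hdet : ∀ i, DependsUpTo i fun ω => ω ∈ A ∧ k * K ≤ visitCount B i ω := by
      obtain ⟨T, _, rfl⟩ := hAm
      have key : ∀ i (ω ω' : ℕ → S), (∀ j ≤ i, ω j = ω' j) → k * K ≤ visitCount B i ω →
          (fun j : Fin k => (batchLength B K j ω, batchTotal B φ K j ω)) =
            fun j : Fin k => (batchLength B K j ω', batchTotal B φ K j ω') := by
        intro i ω ω' h hi
        funext j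
        rw [batchLength_congr hK j.2 h hi, batchTotal_congr φ hK j.2 h hi]
      intro i ω ω' h
      have hN : visitCount B i ω = visitCount B i ω' := visitCount_congr h le_rfl
      simp only [Set.mem_preimage, hN, eq_iff_iff]
      refine and_congr_left fun hi => ?_
      rw [key i ω ω' h (hN ▸ hi)]
    have hmi : ∀ i, MeasurableSet {ω : ℕ → S | visitCount B i ω / K = k} := fun i =>
      (measurable_visitCount i) (MeasurableSet.of_discrete (s := {m | m / K = k}))
    rw [lintegral_tsum fun i => (Measurable.ite (hmi i) measurable_const
      measurable_const).aemeasurable]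
    refine ENNReal.tsum_le_of_sum_range_le fun n => ?_
    have e : ∀ i, ∫⁻ ω in A, (if visitCount B i ω / K = k then (1 : ℝ≥0∞) else 0) ∂P =
        ENNReal.ofReal (P.real {ω | ω ∈ A ∧ visitCount B i ω / K = k}) := by
      intro i
      have e1 : (fun ω : ℕ → S => if visitCount B i ω / K = k then (1 : ℝ≥0∞) else 0) =
          {ω : ℕ → S | visitCount B i ω / K = k}.indicator 1 := by
        funext ω; simp [Set.indicator_apply]
      rw [e1, lintegral_indicator_one (hmi i), Measure.restrict_apply (hmi i), ofReal_measureReal,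
        Set.inter_comm]
      rfl
    rw [Finset.sum_congr rfl fun i _ => e i, ← ENNReal.ofReal_sum_of_nonneg fun i _ =>
      measureReal_nonneg, ← ofReal_measureReal (μ := P) (s := A), ← ENNReal.ofReal_mul hM0]
    exact ENNReal.ofReal_le_ofReal
      (sum_measure_batch_le hstep hδ hF0 hFρ hF hK k hA hdet n)
  obtain ⟨h1, h2⟩ := integrable_and_condExp_le (hm k) (measurable_batchLength K k) hM0
    fun A hA => (lintegral_mono fun ω => batchLength_le_tsum K k ω).trans (hlint k A hA)
  refine ⟨h1, h2, ?_⟩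
  -- The bound for the series, not just for `batchLength`, excludes infinite batches almost surely.
  have hfin : ∀ k, ∀ᵐ ω ∂P, {i | visitCount B i ω / K = k}.Finite := by
    intro k
    have h3 := hlint k Set.univ MeasurableSet.univ
    rw [Measure.restrict_univ, measure_univ, mul_one] at h3
    filter_upwards [ae_lt_top (measurable_batch_indicator K k)
      (h3.trans_lt ENNReal.ofReal_lt_top).ne] with ω hω
    rw [tsum_batch_indicator] at hω
    rw [← Set.encard_lt_top_iff]
    by_contra hinf
    rw [not_lt, top_le_iff] at hinf
    rw [hinf] at hω
    simp at hω
  filter_upwards [ae_all_iff.2 hfin] with ω hω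
  exact le_batchTotal hφ hK hω k

end Batches

/-! ### From the Markov chain to the recurring property. -/

/-- The bound for the factor that is collected in one batch. -/
lemma one_sub_inv_pow_half_le {n C : ℕ} (hn : 2 ≤ n) (hC : n / 2 ≤ C) :
    (1 - 1 / (n : ℝ)) ^ C ≤ 2 / 3 := by
  have hn' : (2 : ℝ) ≤ n := by exact_mod_cast hn
  have hn0 : (0 : ℝ) < n := by linarith
  have hn1 : (0 : ℝ) < n - 1 := by linarith
  have hx : (0 : ℝ) ≤ 1 - 1 / n := by
    rw [sub_nonneg, div_le_one hn0]; linarith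
  have hx1 : 1 - 1 / (n : ℝ) ≤ 1 := by linarith [one_div_pos.2 hn0]
  have h1 : 1 + ((n / 2 : ℕ) : ℝ) * (1 / (n - 1)) ≤ (1 + 1 / ((n : ℝ) - 1)) ^ (n / 2) :=
    one_add_mul_le_pow (by linarith [one_div_pos.2 hn1]) _
  have h2 : ((n : ℝ) - 1) / 2 ≤ ((n / 2 : ℕ) : ℝ) := by
    have : (n : ℝ) ≤ 2 * ((n / 2 : ℕ) : ℝ) + 1 := by
      exact_mod_cast (by omega : n ≤ 2 * (n / 2) + 1)
    linarith
  have h3 : 3 / 2 ≤ (1 + 1 / ((n : ℝ) - 1)) ^ (n / 2) := by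
    have h4 : ((n : ℝ) - 1) / 2 * (1 / (n - 1)) ≤ ((n / 2 : ℕ) : ℝ) * (1 / (n - 1)) := by
      gcongr
    have h5 : ((n : ℝ) - 1) / 2 * (1 / (n - 1)) = 1 / 2 := by field_simp
    linarith
  -- Inverting the base makes Bernoulli's inequality applicable; rounding n/2 down to at least (n -
  -- 1)/2 gives exactly 1 + 1/2.
  have h6 : 1 - 1 / (n : ℝ) = (1 + 1 / ((n : ℝ) - 1))⁻¹ := by field_simp; ring
  calc (1 - 1 / (n : ℝ)) ^ C ≤ (1 - 1 / (n : ℝ)) ^ (n / 2) := pow_le_pow_of_le_one hx hx1 hC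
    _ ≤ (3 / 2)⁻¹ := by
      rw [h6, inv_pow]; exact inv_anti₀ (by norm_num) h3
    _ = 2 / 3 := by norm_num

-- The graph is a function of the configuration, so only matching pairs carry mass.
open Classical in
lemma compressionAdversary_apply {V : Type} [Fintype V] [Nonempty V] [DecidableEq V] {L : ℕ}
    (lam : ℝ) (σ : V → BehaviorGroup) (c c' : LatticeConfig V L) (g : SimpleGraph V) :
    (compressionAdversary V L lam c σ (g, c') = 0 ∨ contactGraph c' = g) ∧
    compressionAdversary V L lam c σ (contactGraph c', c') = iterationKernel lam σ c c' := by
  have h : ∀ g, compressionAdversary V L lam c σ (g, c') =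
      ∑' x, if (g, c') = (contactGraph x, x) then iterationKernel lam σ c x else 0 := fun g =>
    (PMF.map_apply _ _ _).trans (tsum_congr fun x => by congr)
  constructor
  · by_cases hg : contactGraph c' = g
    · exact Or.inr hg
    · left
      rw [h, ENNReal.tsum_eq_zero]
      intro x
      rw [if_neg]
      rintro hx
      rw [Prod.mk.injEq] at hx
      exact hg (by rw [hx.1, ← hx.2])
  · rw [h, tsum_eq_single c']
    · rw [if_pos rfl]
    · intro x hx
      rw [if_neg]
      rintro hx'
      rw [Prod.mk.injEq] at hx'
      exact hx hx'.2.symm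

/-- The Markov chain of the configurations at the iterations is generated by the adversary. -/
lemma isGeneratedFrom_compressionAdversary {V : Type} [Fintype V] [Nonempty V] [DecidableEq V]
    {L : ℕ} [NeZero L] [MeasurableSpace (LatticeConfig V L)]
    [DiscreteMeasurableSpace (LatticeConfig V L)] (lam : ℝ) (σ : V → BehaviorGroup) (t : ℕ)
    (x₀ : LatticeConfig V L) {P : Measure (ℕ → LatticeConfig V L)} [IsProbabilityMeasure P]
    (h0 : P {ω | ω 0 = x₀} = 1)
    (hcyl : ∀ (i : ℕ) (z : ℕ → LatticeConfig V L), P {ω | ∀ j ≤ i + 1, ω j = z j} =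
        P {ω | ∀ j ≤ i, ω j = z j} * iterationKernel lam σ (z i) (z (i + 1))) :
    IsGeneratedFrom (compressionAdversary V L lam) σ t x₀ P
      (fun s ω => contactGraph (ω (s - t + 1))) (fun s ω => ω (s - t + 1)) where
  measurable_graph s A :=
    (measurable_pi_apply (X := fun _ : ℕ => LatticeConfig V L) (s - t + 1))
      (MeasurableSet.of_discrete (s := contactGraph ⁻¹' A))
  measurable_info s A :=
    (measurable_pi_apply (X := fun _ : ℕ => LatticeConfig V L) (s - t + 1))
      (MeasurableSet.of_discrete (s := A))
  law m g x hx := by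
    have hset : {ω : ℕ → LatticeConfig V L | ∀ i < m, contactGraph (ω (t + i - t + 1)) = g i ∧
        ω (t + i - t + 1) = x (i + 1)} =
        {ω | ∀ i < m, contactGraph (ω (i + 1)) = g i ∧ ω (i + 1) = x (i + 1)} := by
      simp only [Nat.add_sub_cancel_left]
    rw [hset]
    have hae : ∀ᵐ ω ∂P, ω 0 = x₀ := by
      rw [ae_iff_measure_eq, h0, measure_univ]
      exact (measurable_pi_apply (X := fun _ : ℕ => LatticeConfig V L) 0
        (MeasurableSet.of_discrete (s := {x₀}))).nullMeasurableSet
    by_cases hg : ∀ i < m, contactGraph (x (i + 1)) = g i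
    · have e1 : P {ω | ∀ i < m, contactGraph (ω (i + 1)) = g i ∧ ω (i + 1) = x (i + 1)} =
          P {ω | ∀ j ≤ m, ω j = x j} := by
        refine measure_congr ?_
        filter_upwards [hae] with ω hω
        refine propext ⟨fun h j hj => ?_, fun h i hi => ?_⟩
        · rcases j with _ | j
          · rw [hω, hx]
          · exact (h j (by omega)).2
        · have := h (i + 1) hi
          exact ⟨by rw [this, hg i hi], this⟩
      have e2 : ∀ m, P {ω | ∀ j ≤ m, ω j = x j} =
          ∏ i ∈ Finset.range m, iterationKernel lam σ (x i) (x (i + 1)) := by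
        intro m
        induction m with
        | zero => simpa [hx] using h0
        | succ m ih => rw [hcyl, ih, Finset.prod_range_succ]
      rw [e1, e2]
      refine Finset.prod_congr rfl fun i hi => ?_
      rw [← hg i (Finset.mem_range.1 hi)]
      exact (compressionAdversary_apply lam σ (x i) (x (i + 1)) (g i)).2.symm
    · push Not at hg
      obtain ⟨i, hi, hne⟩ := hg
      rw [Finset.prod_eq_zero (Finset.mem_range.2 hi)
        ((compressionAdversary_apply lam σ (x i) (x (i + 1)) (g i)).1.resolve_right hne)]
      have : {ω : ℕ → LatticeConfig V L | ∀ i < m, contactGraph (ω (i + 1)) = g i ∧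
          ω (i + 1) = x (i + 1)} = ∅ := by
        ext ω
        simp only [Set.mem_ofPred_eq, Set.mem_empty_iff_false, iff_false]
        intro h
        exact hne (by rw [← (h i hi).2, (h i hi).1])
      rw [this, measure_empty]

end

theorem mainTheorem9 (n L N : ℕ) [NeZero n] [NeZero L] (hN : N = L ^ 2)
    (lam : ℝ) (hlam : 2 + Real.sqrt 2 < lam) :
    IsRecurring (compressionAdversary (Fin n) L lam)
      (2 * (N : ℝ) ^ 2 + 2 / (n : ℝ) + 1) (2 / 3) := by
  refine ⟨by have : 0 ≤ 2 * (N : ℝ) ^ 2 + 2 / (n : ℝ) := by positivity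
             linarith, by norm_num, by norm_num, ?_⟩
  intro t _ x₀ σ hu hv
  let _ : MeasurableSpace (LatticeConfig (Fin n) L) := ⊤
  have _ : DiscreteMeasurableSpace (LatticeConfig (Fin n) L) := ⟨fun _ => trivial⟩
  have _ : Nonempty (LatticeConfig (Fin n) L) := ⟨x₀⟩
  have hn : 2 ≤ n := by
    obtain ⟨u, hu⟩ := hu
    obtain ⟨v, hv⟩ := hv
    have huv : u ≠ v := by rintro rfl; rw [hu] at hv; cases hv
    by_contra hlt
    exact huv (Fin.ext (by omega))
  obtain ⟨ρ, F, hρ, hbound, hF0, hFρ, hF⟩ := exists_movement_potential lam hu hv x₀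
  obtain ⟨P, hP, h0, hcyl, hstep⟩ := exists_markovChain (iterationKernel lam σ) x₀
  have hK : 0 < n / 2 := Nat.div_pos hn two_pos
  set φ : LatticeConfig (Fin n) L → ℕ := fun c => activeCount σ (contactGraph c) with hφ
  have hn' : (2 : ℝ) ≤ n := by exact_mod_cast hn
  have hδ : 0 ≤ ρ * (2 / Fintype.card (Fin n)) := by positivity
  have hbatch := batch_bounds (B := HasContact σ) hstep hρ hδ hF0 hFρ
    (fun c => iterationKernel_drift hF c) (φ := φ) (fun c hc => hc.one_le_activeCount) hK
  have hM : ((n / 2 : ℕ) : ℝ) + ρ + ((n / 2 : ℕ) : ℝ) * (ρ * (2 / Fintype.card (Fin n))) ≤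
      2 * (N : ℝ) ^ 2 + 2 / (n : ℝ) + 1 := by
    rw [Fintype.card_fin] at hbound ⊢
    have h1 : ((n / 2 : ℕ) : ℝ) ≤ n / 2 := Nat.cast_div_le
    have h2 : ((n / 2 : ℕ) : ℝ) * (ρ * (2 / n)) ≤ (n / 2 : ℝ) * (ρ * (2 / n)) := by gcongr
    have h3 : (n / 2 : ℝ) * (ρ * (2 / n)) = ρ := by field_simp
    have h4 : (N : ℝ) ^ 2 = (L : ℝ) ^ 4 := by rw [hN]; push_cast; ring
    have h5 : 0 ≤ 2 / (n : ℝ) := by positivity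
    rw [h4]
    linarith
  -- Coordinate 0 of the chain is the configuration before iteration `t`, so iteration `s` is read
  -- at coordinate `s - t + 1`; values for `s < t` are irrelevant.
  refine ⟨ℕ → LatticeConfig (Fin n) L, inferInstance, P, hP,
    fun s ω => contactGraph (ω (s - t + 1)), fun s ω => ω (s - t + 1),
    batchLength (HasContact σ) (n / 2), batchTotal (HasContact σ) φ (n / 2),
    isGeneratedFrom_compressionAdversary lam σ t x₀ h0 hcyl, fun k => ?_⟩
  obtain ⟨hint, hD, hC⟩ := hbatch k
  refine ⟨measurable_batchLength _ k, measurable_batchTotal φ _ k, fun ω => ?_, hint, ?_, ?_⟩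
  · rw [batchTotal, add_comm t, add_comm t, ← Finset.sum_Ico_add]
    simp only [Nat.add_sub_cancel_left, hφ]
  · filter_upwards [hD] with ω hω
    exact hω.trans hM
  · rw [Fintype.card_fin]
    have hm : batchHistory (batchLength (HasContact σ) (n / 2))
        (batchTotal (HasContact σ) φ (n / 2)) k ≤ MeasurableSpace.pi := by
      have h : Measurable fun (ω : ℕ → LatticeConfig (Fin n) L) (i : Fin k) =>
          (batchLength (HasContact σ) (n / 2) i ω, batchTotal (HasContact σ) φ (n / 2) i ω) :=
        measurable_pi_lambda _ fun i =>
          (measurable_batchLength _ i).prodMk (measurable_batchTotal φ _ i)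
      exact h.comap_le
    have hx0 : (0 : ℝ) ≤ 1 - 1 / n := by
      rw [sub_nonneg, div_le_one (by linarith)]; linarith
    have hx1 : (1 : ℝ) - 1 / n ≤ 1 := by
      have : (0 : ℝ) ≤ 1 / n := by positivity
      linarith
    have hmeas : Measurable fun ω : ℕ → LatticeConfig (Fin n) L =>
        (1 - 1 / (n : ℝ)) ^ batchTotal (HasContact σ) φ (n / 2) k ω :=
      (measurable_from_nat (f := fun m => (1 - 1 / (n : ℝ)) ^ m)).comp
        (measurable_batchTotal φ _ k)
    have hi : Integrable (fun ω : ℕ → LatticeConfig (Fin n) L =>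
        (1 - 1 / (n : ℝ)) ^ batchTotal (HasContact σ) φ (n / 2) k ω) P :=
      Integrable.of_bound hmeas.aestronglyMeasurable 1 (Filter.Eventually.of_forall fun ω => by
        rw [Real.norm_of_nonneg (by positivity)]
        exact pow_le_one₀ hx0 hx1)
    have hmono := condExp_mono (m := batchHistory (batchLength (HasContact σ) (n / 2))
        (batchTotal (HasContact σ) φ (n / 2)) k) hi (integrable_const (2 / 3 : ℝ)) (by
      filter_upwards [hC] with ω hω
      exact one_sub_inv_pow_half_le hn hω)
    rw [condExp_const hm] at hmono
    exact hmono
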